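/- Let $(K,v)$ be a valued field with value group $\Gamma$ and residue field $k$, let $\Gamma_{\mathbb Q}=\Gamma\otimes\mathbb Q$, let $\bar v$ be an extension of $v$ to an algebraic closure of $K$, and let $(K^h,v^h)$ be the henselization of $(K,v)$ determined by $\bar v$. For a polynomial $\phi$ and a valuation $\mu$ on $K[x]$ (with values in $\Gamma_{\mathbb Q}\cup\{\infty\}$ and extending $v$), or for $(\mu,\phi)=(v,x)$, write $\phi$-expansions as $f=\sum_n a_n\phi^n$ with $\deg a_n<\deg \phi$. Let $N_{\mu,\phi}(f)\subset\mathbb Q\times\Gamma_{\mathbb Q}$ be the Newton polygon of $f$, i.e. the lower convex hull of the points $(n,\mu(a_n))$, and let $[\mu;\phi,\lambda]$ be the augmented valuation $f\mapsto\min_n(\mu(a_n)+n\lambda)$. For a valuation $\mu$ on $K[x]$ let $\mathcal G_\mu$ be its graded algebra, $\operatorname{in}_\mu f\in\mathcal G_\mu$ the initial term of $f$, $\kappa(\mu)$ the algebraic closure of $k$ in the degree-zero part of $\mathcal G_\mu$, and $R_{\mu,\phi}(f)\in\kappa(\mu)[y]$ the residual polynomial of $f$ with respect to a key polynomial $\phi$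 of minimal degree (and a fixed homogeneous unit of $\mathcal G_\mu$ of grade $e\mu(\phi)$, where $e$ is the relative ramification index of $\mu$). Let $g\in K[x]$ be monic and square-free with $\operatorname{char}(k)\nmid\deg g$, and suppose that $g$ is reducible in $K^h[x]$. Let $(\mu,\phi)$ be a splitting pair of $g$: the last pair considered in the following irreducibility test. Start with $\mu=v$, $\phi=x$, $n=\deg g$. While $n>1$: if $N_{\mu,\phi}(g)$ is one-sided of slope $-\lambda$, replace $\mu$ by $[\mu;\phi,\lambda]$, and otherwise return False; if $R_{\mu,\phi}(g)=\psi^m$ with $\psi$ irreducible over $\kappa(\mu)$, replace $\phi$ by the approximate root $\sqrt[m]{g}$ and $n$ by $m$, and otherwise return False. Let $-\lambda$ be the largest slope of $N_{\mu,\phi}(g)$, let $\mu_\lambda=[\mu;\phi,\lambda]$, and let $n_0\ge 0$ be the abscissa of the left endpoint of the side of slope $-\lambda$. Let $R_{\mu_\lambda,\phi}(g)=\psi_1^{n_1}\cdots\psi_s^{n_s}$ with $\psi_1,\dots,\psi_s\in\kappa(\mu_\lambda)[y]$ pairwise different, monic and irreducible, and $n_1,\dots,n_s\ge1$. Put $\varphi_0=\phi$,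 and for $1\le i\le s$ let $\varphi_i$ be a key polynomial for $\mu_\lambda$ with $R_{\mu_\lambda,\phi}(\varphi_i)=\psi_i$. Let $\mu_\lambda^h$ be the common extension of $\mu_\lambda$ and $v^h$ to $K^h[x]$, and let $G_0,\dots,G_s\in K^h[x]$ be the monic polynomials with $$g=G_0\cdots G_s,\qquad \operatorname{in}_{\mu_\lambda^h}G_i=\operatorname{in}_{\mu_\lambda^h}\varphi_i^{n_i},\qquad \deg G_i=\deg \varphi_i^{n_i}\quad(0\le i\le s).$$ Let $\gamma=\mu_\lambda(g-\varphi_0^{n_0}\cdots\varphi_s^{n_s})-\mu_\lambda(g)\in\Gamma_{\mathbb Q}\cup\{\infty\}$. Then $\gamma>0$, and for all $n\in\mathbb N$ one can compute monic polynomials $G_0^{(n)},\dots,G_s^{(n)}\in K[x]$ such that, for $0\le i\le s$, $$\mu_\lambda^h\bigl(G_i-G_i^{(n)}\bigr)>\mu_\lambda^h(G_i)+2^n\gamma\quad\text{if }\gamma\neq\infty,\qquad\text{and}\qquad G_i^{(n)}=G_i\quad\text{if }\gamma=\infty.$$ Here "compute" means: there are two programs, not depending on the field, the valuation or the other data, which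 use only $0$, $1$, addition, subtraction, multiplication, Euclidean division and degrees of polynomials in one variable over the field, tests for zero, manipulation of lists, and recursion along lists. The first one computes $(G_i^{(0)})_i$ from $g$ and $(\varphi_i,n_i)_i$, and the second one (the Hensel step) computes $(G_i^{(n+1)})_i$ from $g$ and $(G_i^{(n)})_i$ for every $n$; so the guaranteed precision $2^n\gamma$ is doubled at each step (quadratic convergence). -/

import Mathlib

open Polynomial

namespace OM

noncomputable section

universe u v w

/-! ## Graded algebra of a valuation on `K[x]` -/

section Graded

variable {K : Type u} [Field K] {Γ : Type v} [AddCommGroup Γ] [LinearOrder Γ]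
  [IsOrderedAddMonoid Γ]

/-- The subring `⨁_α P_α t^α` of the group algebra `K[x][t^Γ]`, where `P_α = {f | μ f ≥ α}`. -/
def rees (μ : AddValuation K[X] (WithTop Γ)) : Subring (AddMonoidAlgebra K[X] Γ) where
  carrier := {F | ∀ α : Γ, (α : WithTop Γ) ≤ μ (F.coeff α)}
  zero_mem' := by
    intro α
    simp
  one_mem' := by
    intro α
    classical
    rw [AddMonoidAlgebra.one_def, AddMonoidAlgebra.coeff_single, Finsupp.single_apply]
    split_ifs with h
    · subst h; simp
    · simp
  add_mem' := by
    intro F G hF hG α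
    rw [AddMonoidAlgebra.coeff_add, Finsupp.add_apply]
    exact μ.map_le_add (hF α) (hG α)
  neg_mem' := by
    intro F hF α
    rw [AddMonoidAlgebra.coeff_neg, Finsupp.neg_apply, AddValuation.map_neg]
    exact hF α
  mul_mem' := by
    intro F G hF hG α
    classical
    rw [AddMonoidAlgebra.coeff_mul]
    refine μ.map_le_sum fun β _ => μ.map_le_sum fun δ _ => ?_
    beta_reduce
    split_ifs with h
    · subst h
      rw [AddValuation.map_mul, WithTop.coe_add]
      exact add_le_add (hF β) (hG δ)
    · simp

/-- The ideal `⨁_α P_α⁺ t^α` of `⨁_α P_α t^α`, where `P_α⁺ = {f | μ f > α}`. -/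
def reesIdeal (μ : AddValuation K[X] (WithTop Γ)) : Ideal (rees μ) where
  carrier := {F | ∀ α : Γ, (α : WithTop Γ) < μ (F.1.coeff α)}
  zero_mem' := by
    intro α
    simp
  add_mem' := by
    intro F G hF hG α
    change _ < μ ((F.1 + G.1).coeff α)
    rw [AddMonoidAlgebra.coeff_add, Finsupp.add_apply]
    exact μ.map_lt_add (hF α) (hG α)
  smul_mem' := by
    intro F G hG α
    classical
    change _ < μ ((F.1 * G.1).coeff α)
    rw [AddMonoidAlgebra.coeff_mul]
    refine μ.map_lt_sum (WithTop.coe_ne_top) fun β _ =>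
      μ.map_lt_sum (WithTop.coe_ne_top) fun δ _ => ?_
    beta_reduce
    split_ifs with h
    · subst h
      rw [AddValuation.map_mul, WithTop.coe_add]
      exact WithTop.add_lt_add_of_le_of_lt WithTop.coe_ne_top (F.2 β) (hG δ)
    · simp

/-- The graded algebra `𝒢_μ = ⨁_α P_α / P_α⁺`. -/
def Gr (μ : AddValuation K[X] (WithTop Γ)) : Type (max u v) := rees μ ⧸ reesIdeal μ

instance (μ : AddValuation K[X] (WithTop Γ)) : CommRing (Gr μ) :=
  inferInstanceAs (CommRing (rees μ ⧸ reesIdeal μ))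

/-- The homogeneous element `f + P_α⁺` of grade `α`, for `f ∈ P_α`. -/
def cls (μ : AddValuation K[X] (WithTop Γ)) (α : Γ) (f : K[X]) (h : (α : WithTop Γ) ≤ μ f) :
    Gr μ :=
  Ideal.Quotient.mk (reesIdeal μ) ⟨AddMonoidAlgebra.single α f, by
    classical
    intro β
    rw [AddMonoidAlgebra.coeff_single, Finsupp.single_apply]
    split_ifs with hαβ
    · subst hαβ; exact h
    · simp⟩

open Classical in
/-- The initial term `in_μ f = f + P_{μ(f)}⁺`, with `in_μ f = 0` for `f` in the support of `μ`. -/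
def inTerm (μ : AddValuation K[X] (WithTop Γ)) (f : K[X]) : Gr μ :=
  if h : μ f = ⊤ then 0 else cls μ ((μ f).untop h) f (WithTop.coe_untop _ h).le

/-- Key polynomials of `μ`: monic, `μ`-minimal and `μ`-irreducible. -/
structure IsKeyPolynomial (μ : AddValuation K[X] (WithTop Γ)) (φ : K[X]) : Prop where
  monic : φ.Monic
  minimal : ∀ f : K[X], f ≠ 0 → f.natDegree < φ.natDegree → ¬ inTerm μ φ ∣ inTerm μ f
  irreducible : Prime (inTerm μ φ)

theorem cls_zero (μ : AddValuation K[X] (WithTop Γ)) (h : ((0 : Γ) : WithTop Γ) ≤ μ 0) :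
    cls μ 0 0 h = 0 :=
  Ideal.Quotient.eq_zero_iff_mem.2 fun α => by simp

theorem cls_one (μ : AddValuation K[X] (WithTop Γ)) (h : ((0 : Γ) : WithTop Γ) ≤ μ 1) :
    cls μ 0 1 h = 1 := rfl

theorem cls_add (μ : AddValuation K[X] (WithTop Γ)) {f g k : K[X]}
    (hf : ((0 : Γ) : WithTop Γ) ≤ μ f) (hg : ((0 : Γ) : WithTop Γ) ≤ μ g)
    (hk : ((0 : Γ) : WithTop Γ) ≤ μ k) (h : k = f + g) :
    cls μ 0 k hk = cls μ 0 f hf + cls μ 0 g hg := by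
  subst h
  refine congrArg (Ideal.Quotient.mk (reesIdeal μ)) (Subtype.ext ?_)
  exact AddMonoidAlgebra.single_add ..

theorem cls_neg (μ : AddValuation K[X] (WithTop Γ)) {f k : K[X]}
    (hf : ((0 : Γ) : WithTop Γ) ≤ μ f) (hk : ((0 : Γ) : WithTop Γ) ≤ μ k) (h : k = -f) :
    cls μ 0 k hk = -cls μ 0 f hf := by
  subst h
  refine congrArg (Ideal.Quotient.mk (reesIdeal μ)) (Subtype.ext ?_)
  exact AddMonoidAlgebra.single_neg ..

theorem cls_mul (μ : AddValuation K[X] (WithTop Γ)) {f g k : K[X]}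
    (hf : ((0 : Γ) : WithTop Γ) ≤ μ f) (hg : ((0 : Γ) : WithTop Γ) ≤ μ g)
    (hk : ((0 : Γ) : WithTop Γ) ≤ μ k) (h : k = f * g) :
    cls μ 0 k hk = cls μ 0 f hf * cls μ 0 g hg := by
  subst h
  refine congrArg (Ideal.Quotient.mk (reesIdeal μ)) (Subtype.ext ?_)
  change AddMonoidAlgebra.single 0 (f * g) =
    AddMonoidAlgebra.single 0 f * AddMonoidAlgebra.single 0 g
  rw [AddMonoidAlgebra.single_mul_single, add_zero]

/-- The subring `Δ_μ = P_0 / P_0⁺` of elements of grade zero of `𝒢_μ`. -/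
def gradeZero (μ : AddValuation K[X] (WithTop Γ)) : Subring (Gr μ) where
  carrier := {x | ∃ (f : K[X]) (h : ((0 : Γ) : WithTop Γ) ≤ μ f), x = cls μ 0 f h}
  zero_mem' := ⟨0, by simp, (cls_zero μ _).symm⟩
  one_mem' := ⟨1, by simp, (cls_one μ _).symm⟩
  add_mem' := by
    rintro _ _ ⟨f, hf, rfl⟩ ⟨g, hg, rfl⟩
    exact ⟨f + g, μ.map_le_add hf hg, (cls_add μ _ _ _ rfl).symm⟩
  neg_mem' := by
    rintro _ ⟨f, hf, rfl⟩
    exact ⟨-f, by rwa [AddValuation.map_neg], (cls_neg μ _ _ rfl).symm⟩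
  mul_mem' := by
    rintro _ _ ⟨f, hf, rfl⟩ ⟨g, hg, rfl⟩
    exact ⟨f * g, by rw [AddValuation.map_mul]; exact add_nonneg hf hg,
      (cls_mul μ _ _ _ rfl).symm⟩

/-- The image of the residue field `k` of `K` in `Δ_μ`: the classes of the constants `a ∈ K`
of nonnegative value. -/
def baseResidue (μ : AddValuation K[X] (WithTop Γ)) : Subring (Gr μ) where
  carrier := {x | ∃ (a : K) (h : ((0 : Γ) : WithTop Γ) ≤ μ (C a)), x = cls μ 0 (C a) h}
  zero_mem' := ⟨0, by simp, by simp only [C_0]; exact (cls_zero μ _).symm⟩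
  one_mem' := ⟨1, by simp, by simp only [C_1]; exact (cls_one μ _).symm⟩
  add_mem' := by
    rintro _ _ ⟨f, hf, rfl⟩ ⟨g, hg, rfl⟩
    exact ⟨f + g, by rw [C_add]; exact μ.map_le_add hf hg, (cls_add μ _ _ _ C_add).symm⟩
  neg_mem' := by
    rintro _ ⟨f, hf, rfl⟩
    exact ⟨-f, by rwa [C_neg, AddValuation.map_neg], (cls_neg μ _ _ C_neg).symm⟩
  mul_mem' := by
    rintro _ _ ⟨f, hf, rfl⟩ ⟨g, hg, rfl⟩
    exact ⟨f * g, by rw [C_mul, AddValuation.map_mul]; exact add_nonneg hf hg,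
      (cls_mul μ _ _ _ C_mul).symm⟩

/-- The field `κ(μ)`, the relative algebraic closure of `k` in `Δ_μ`. -/
def kappa (μ : AddValuation K[X] (WithTop Γ)) : Subring (Gr μ) :=
  (integralClosure (baseResidue μ) (Gr μ)).toSubring ⊓ gradeZero μ

end Graded

/-! ## `φ`-expansions, augmentations and residual polynomials -/

section Residual

variable {K : Type u} [Field K] {Γ : Type v} [AddCommGroup Γ] [LinearOrder Γ]
  [IsOrderedAddMonoid Γ]

/-- The coefficient `a_n` of the `φ`-expansion `f = ∑ a_n φ^n`, `deg a_n < deg φ`, for monic `φ`. -/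
def digit (φ f : K[X]) (n : ℕ) : K[X] := (f /ₘ φ ^ n) %ₘ φ

/-- The first entry of a pair `(μ, φ)`: either a valuation on `K[x]`, or `v` itself (`none`).
This is the function giving the values of the coefficients of `φ`-expansions; in the case of `v`
it is only used with `φ = x`, when these coefficients are constants. -/
def nodeVal (v : AddValuation K (WithTop Γ)) :
    Option (AddValuation K[X] (WithTop Γ)) → K[X] → WithTop Γ
  | none => fun f => v (f.coeff 0)
  | some μ => fun f => μ f

/-- `μ' = [μ; φ, lam]` (or `[v; x, lam]`): `μ'(∑ a_n φ^n) = min_n (μ(a_n) + n lam)`. -/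
def IsAugmentation (ρ : K[X] → WithTop Γ) (φ : K[X]) (lam : Γ)
    (μ' : AddValuation K[X] (WithTop Γ)) : Prop :=
  ∀ f : K[X], μ' f =
    (Finset.range (f.natDegree + 1)).inf fun n => ρ (digit φ f n) + ((n • lam : Γ) : WithTop Γ)

/-- `S_{μ,φ}(g)`: the indices `n` for which `μ(a_n φ^n) = μ(g)`. -/
def minIndices (μ : AddValuation K[X] (WithTop Γ)) (φ g : K[X]) : Set ℕ :=
  {n | μ (digit φ g n * φ ^ n) = μ g}

/-- The relative ramification index `e` of `μ`, for `φ` a key polynomial of minimal degree: the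
least positive integer with `e μ(φ) ∈ {μ(a) | a ≠ 0, deg a < deg φ}`. -/
def relRamIndex (μ : AddValuation K[X] (WithTop Γ)) (φ : K[X]) : ℕ :=
  sInf {e | 0 < e ∧ ∃ a : K[X], a ≠ 0 ∧ a.natDegree < φ.natDegree ∧ μ a = e • μ φ}

/-- `t` is a homogeneous unit of `𝒢_μ` of grade `e μ(φ)`. -/
def IsResidualUnit (μ : AddValuation K[X] (WithTop Γ)) (φ : K[X]) (t : Gr μ) : Prop :=
  IsUnit t ∧ ∃ b : K[X], μ b = relRamIndex μ φ • μ φ ∧ t = inTerm μ b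

open Classical in
/-- The residual polynomial `R_{μ,φ,t}(g) = ζ_0 + ζ_1 y + ⋯ + ζ_d y^d` with
`ζ_j = in(a_ℓ)⁻¹ t^{j-d} in(a_{ℓ_j})` if `ℓ_j = ℓ_0 + j e` lies in `S_{μ,φ}(g)` and `ζ_j = 0`
otherwise, where `ℓ_0` and `ℓ = ℓ_0 + d e` are the least and the greatest element of
`S_{μ,φ}(g)`. -/
def residualPoly (μ : AddValuation K[X] (WithTop Γ)) (φ : K[X]) (t : Gr μ) (g : K[X]) :
    (Gr μ)[X] :=
  let S := minIndices μ φ g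
  let e := relRamIndex μ φ
  let l₀ := sInf S
  let l := sSup S
  let d := (l - l₀) / e
  if g = 0 then 0 else
    ∑ j ∈ Finset.range (d + 1),
      if l₀ + j * e ∈ S then
        C (Ring.inverse (inTerm μ (digit φ g l)) * Ring.inverse t ^ (d - j) *
          inTerm μ (digit φ g (l₀ + j * e))) * X ^ j
      else 0

end Residual

/-! ## Newton polygons -/

section Newton

variable {K : Type u} [Field K] {Γ : Type v} [AddCommGroup Γ] [LinearOrder Γ]
  [IsOrderedAddMonoid Γ] [Module ℚ Γ]

/-- The Newton polygon of `g`: the lower convex hull in `ℚ × Γ` of the points `(n, ρ(a_n))`,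
where `g = ∑ a_n φ^n` is the `φ`-expansion. -/
def newtonPolygon (ρ : K[X] → WithTop Γ) (φ g : K[X]) : Set (ℚ × Γ) :=
  let H : Set (ℚ × Γ) :=
    convexHull ℚ {P | ∃ n : ℕ, P.1 = n ∧ ρ (digit φ g n) = (P.2 : WithTop Γ)}
  {P | P ∈ H ∧ ∀ β : Γ, (P.1, β) ∈ H → P.2 ≤ β}

/-- The `lam`-component `S_lam(N)`: the points of `N` lying on the line of slope `-lam` which
first touches `N` from below. -/
def component (N : Set (ℚ × Γ)) (lam : Γ) : Set (ℚ × Γ) :=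
  {P | P ∈ N ∧ ∀ Q ∈ N, P.2 + P.1 • lam ≤ Q.2 + Q.1 • lam}

/-- `N` is one-sided of slope `-lam`. -/
def IsOneSided (N : Set (ℚ × Γ)) (lam : Γ) : Prop :=
  N = component N lam ∧ IsLeast (Prod.fst '' component N lam) 0 ∧
    ∃ P ∈ component N lam, 0 < P.1

/-- `N` has a side of slope `-lam`. -/
def HasSlope (N : Set (ℚ × Γ)) (lam : Γ) : Prop :=
  ∃ P ∈ component N lam, ∃ Q ∈ component N lam, P.1 ≠ Q.1

/-- `-lam` is the right end-slope of `N`, that is, its largest slope. -/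
def IsRightEndSlope (N : Set (ℚ × Γ)) (lam : Γ) : Prop :=
  HasSlope N lam ∧ ∀ ε : Γ, HasSlope N ε → lam ≤ ε

/-- `Q` is the approximate root of `g` of order `m`: it is monic of degree `deg g / m` and the
coefficient of `Q^(m-1)` in the `Q`-expansion of `g` vanishes. -/
def IsApproximateRoot (m : ℕ) (g Q : K[X]) : Prop :=
  0 < m ∧ Q.Monic ∧ m * Q.natDegree = g.natDegree ∧ digit Q g (m - 1) = 0

/-- `R_{μ,φ,t}(g)` is the `m`-th power of a monic irreducible polynomial in `κ(μ)[y]`. -/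
def IsResidualPower (μ : AddValuation K[X] (WithTop Γ)) (φ : K[X]) (t : Gr μ) (g : K[X])
    (m : ℕ) : Prop :=
  ∃ ψ : (kappa μ)[X], ψ.Monic ∧ Irreducible ψ ∧
    residualPoly μ φ t g = (ψ ^ m).map (kappa μ).subtype

/-- `Reach v g μ φ n`: the triple `(μ, φ, n)` occurs as values of the variables when the condition
`n > 1` of the loop is tested in the following irreducibility test for `g`, where `none` stands
for `v`.

* `μ ← v; φ ← x; n ← deg g`
* while `n > 1` do
  * if `N_{μ,φ}(g)` is one-sided (of slope `-lam`) then `μ ← [μ; φ, lam]` else return False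
  * if `R_{μ,φ}(g) = ψ^m` for some irreducible `ψ` over `κ(μ)` then `φ ←` the approximate root of
    `g` of order `m`, else return False
  * `n ← m`
* return True -/
inductive Reach (v : AddValuation K (WithTop Γ)) (g : K[X]) :
    Option (AddValuation K[X] (WithTop Γ)) → K[X] → ℕ → Prop
  | start : Reach v g none X g.natDegree
  | step {ν : Option (AddValuation K[X] (WithTop Γ))} {φ : K[X]} {n : ℕ} {lam : Γ}
      {μ : AddValuation K[X] (WithTop Γ)} {t : Gr μ} {m : ℕ} {Q : K[X]} :
      Reach v g ν φ n → 1 < n →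
      IsOneSided (newtonPolygon (nodeVal v ν) φ g) lam →
      IsAugmentation (nodeVal v ν) φ lam μ →
      IsResidualUnit μ φ t →
      IsResidualPower μ φ t g m →
      IsApproximateRoot m g Q →
      Reach v g (some μ) Q m

/-- The test returns False in the run of the body of the loop that starts with `(ν, φ)`. -/
def ReturnsFalse (v : AddValuation K (WithTop Γ)) (g : K[X])
    (ν : Option (AddValuation K[X] (WithTop Γ))) (φ : K[X]) : Prop :=
  (¬ ∃ lam : Γ, IsOneSided (newtonPolygon (nodeVal v ν) φ g) lam) ∨
    ∃ (lam : Γ) (μ : AddValuation K[X] (WithTop Γ)) (t : Gr μ),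
      IsOneSided (newtonPolygon (nodeVal v ν) φ g) lam ∧
      IsAugmentation (nodeVal v ν) φ lam μ ∧
      IsResidualUnit μ φ t ∧
      ¬ ∃ m : ℕ, IsResidualPower μ φ t g m

/-- A splitting pair of `g`: a pair `(μ, φ)` considered in the last call of the loop of the
irreducibility test. -/
def IsSplittingPair (v : AddValuation K (WithTop Γ)) (g : K[X])
    (ν : Option (AddValuation K[X] (WithTop Γ))) (φ : K[X]) : Prop :=
  ∃ n : ℕ, Reach v g ν φ n ∧ (n ≤ 1 ∨ ReturnsFalse v g ν φ)

end Newton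

/-! ## Henselization -/

section Henselization

variable (K : Type u) [Field K] {L : Type w} [Field L] [Algebra K L]
  {Γ : Type v} [AddCommGroup Γ] [LinearOrder Γ] [IsOrderedAddMonoid Γ]

/-- The decomposition group `{σ ∈ Gal(Kˢᵉᵖ/K) | v̄ ∘ σ = v̄}` of a valuation `v̄` on an algebraic
closure `L` of `K`, where `Kˢᵉᵖ` is the separable closure of `K` in `L`. -/
def decompositionGroup (vbar : AddValuation L (WithTop Γ)) :
    Subgroup (separableClosure K L ≃ₐ[K] separableClosure K L) where
  carrier := {σ | ∀ x : separableClosure K L, vbar (σ x : L) = vbar (x : L)}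
  one_mem' := fun _ => rfl
  mul_mem' := fun {σ τ} hσ hτ x => (hσ (τ x)).trans (hτ x)
  inv_mem' := fun {σ} hσ x => by
    have h := hσ (σ⁻¹ x)
    rw [← AlgEquiv.mul_apply, mul_inv_cancel, AlgEquiv.one_apply] at h
    exact h.symm

/-- The henselization `Kʰ` of `K` determined by `v̄`: the fixed field of the decomposition group. -/
abbrev Henselization (vbar : AddValuation L (WithTop Γ)) :
    IntermediateField K (separableClosure K L) :=
  IntermediateField.fixedField (decompositionGroup K vbar)

/-- The valuation `vʰ` on `Kʰ`: the restriction of `v̄`. -/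
def henselVal (vbar : AddValuation L (WithTop Γ)) :
    AddValuation (Henselization K vbar) (WithTop Γ) :=
  vbar.comap ((algebraMap (separableClosure K L) L).comp
    (algebraMap (Henselization K vbar) (separableClosure K L)))

end Henselization

/-! ## Algorithms -/

/-- Binary trees with leaves labelled by elements of `R`, used as data structures. -/
inductive Data (R : Type u) : Type u
  | nil : Data R
  | leaf (a : R) : Data R
  | node (l r : Data R) : Data R

namespace Data

variable {R : Type u}

/-- A list of data as a datum. -/
def ofList : List (Data R) → Data R
  | [] => nil
  | a :: l => node a (ofList l)

/-- A natural number in unary notation. -/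
def ofNat (n : ℕ) : Data R := ofList (List.replicate n nil)

/-- Apply an operation of `R` to a pair of elements of `R`. -/
def op (f : R → R → R) : Data R → Data R
  | node (leaf a) (leaf b) => leaf (f a b)
  | _ => nil

/-- First entry of a pair. -/
def left : Data R → Data R
  | node l _ => l
  | _ => nil

/-- Second entry of a pair. -/
def right : Data R → Data R
  | node _ r => r
  | _ => nil

/-- Recursion along a list. -/
def fold (b : Data R) (f : Data R → Data R → Data R) : Data R → Data R
  | node h t => f h (fold b f t)
  | _ => b

end Data

/-- Programs of a functional language computing with polynomials in one variable over an
arbitrary field, with the operations `0, 1, +, -, *` and Euclidean division of polynomials, the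
degree, tests for zero and for the empty list, pairing, composition, and recursion along lists. A
program has no access to other constants of the field and no access to a valuation. -/
inductive Prog : Type
  | nil | zero | one | id
  | comp (p q : Prog)
  | pair (p q : Prog)
  | left | right
  | add | sub | mul | quo | rem
  | deg
  | ifZero (p q r : Prog)
  | ifNil (p q r : Prog)
  | fold (p q : Prog)

namespace Prog

/-- The degree of a polynomial, in unary notation. -/
def degree {K : Type u} [Field K] : Data K[X] → Data K[X]
  | .leaf a => Data.ofNat a.natDegree
  | _ => .nil

open Classical in
/-- The output of a program. In the last clause, `fold p q` applied to `(c, [x₁, …, x_k])` is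
`q(c, (x₁, q(c, (x₂, … q(c, (x_k, p(c)))…))))`. Division by zero gives quotient `0`. -/
def run {K : Type u} [Field K] : Prog → Data K[X] → Data K[X]
  | nil, _ => .nil
  | zero, _ => .leaf 0
  | one, _ => .leaf 1
  | id, x => x
  | comp p q, x => run p (run q x)
  | pair p q, x => .node (run p x) (run q x)
  | left, x => x.left
  | right, x => x.right
  | add, x => x.op (· + ·)
  | sub, x => x.op (· - ·)
  | mul, x => x.op (· * ·)
  | quo, x => x.op (· / ·)
  | rem, x => x.op (· % ·)
  | deg, x => degree x
  | ifZero p q r, x => if run p x = .leaf 0 then run q x else run r x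
  | ifNil p q r, x => if run p x = .nil then run q x else run r x
  | fold p q, x =>
      Data.fold (run p x.left) (fun h t => run q (.node x.left (.node h t))) x.right

end Prog

/-- A finite sequence of polynomials as a datum. -/
def encodePolys {K : Type u} [Field K] {s : ℕ} (f : Fin s → K[X]) : Data K[X] :=
  Data.ofList (List.ofFn fun i => Data.leaf (f i))

/-- The input `(g, [(φ_0, n_0), …, (φ_s, n_s)])` as a datum. -/
def encodeInput {K : Type u} [Field K] {s : ℕ} (g : K[X]) (φ : Fin s → K[X]) (n : Fin s → ℕ) :
    Data K[X] :=
  Data.node (Data.leaf g)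
    (Data.ofList (List.ofFn fun i => Data.node (Data.leaf (φ i)) (Data.ofNat (n i))))

end

end OM

/-!
The Hensel step is Newton's iteration. Given monic approximations `H i` of the factors `G i`, it
solves the linearized equation `g - ∏ H i = ∑ δ i ∏_{j ≠ i} H j` with `deg δ i < deg H i`
exactly, by inverting `∏_{j ≠ i} H j` modulo `H i` with the extended Euclidean algorithm, and
replaces `H i` by `H i + δ i`. The first program performs one such step from the powers
`φᵢ ^ nᵢ`, whose relative precision is exactly `γ`, so the `n`-th output has relative precision at
least `2 ^ (n + 1) γ`, which exceeds `2 ^ n γ`.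

The estimates rest on one property, `Separated`: in a sum `∑ δ i ∏_{j ≠ i} H j` with
`deg δ i < deg H i` the terms never cancel. Over `K` this holds because the initial terms of the
`φᵢ ^ nᵢ` are pairwise coprime and divide no initial term of a polynomial of smaller degree
(`InitialSystem.separated`). Here `φ₁, …, φ_s` are key polynomials with distinct residual
polynomials, and residual polynomials depend only on initial terms, so their initial terms are
nonassociate primes; the initial term of `φ₀ = φ` need not be prime, it suffices that no other `φᵢ`
divides it, which follows from its trivial residual polynomial (`IsAugmentation.initialSystem`).

The exact factors have coefficients in the henselization, so `Separated` is needed over `Kʰ`. The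
henselization is an immediate extension (`henselization_exists_approx`), and since `μ` is built
from `v` by augmentations, every polynomial over `Kʰ` agrees to first order with a polynomial over
`K` of no larger degree (`Reach.hasApproximation`, `HasApproximation.augmentation`). A cancellation
over `Kʰ` would therefore produce one over `K` (`Separated.map`).

That the henselization is immediate is seen as follows. An element `c` fixed by the decomposition
group is multiplied by a power of an element of `K(c)` which is a unit at the given place and
vanishes at its conjugates that move `c`; such an element exists because extensions of `v` to a
Galois extension are conjugate. The product has a value different from those of its other
conjugates, and then a quotient of two consecutive coefficients of its minimal polynomial over `K`
approximates it. Applying this to `c` and to `1` gives an approximation of `c`.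

Divisibility of initial terms is expressed in `K[x]` itself, by the relation `InDvd`.
-/

namespace OM

noncomputable section

/-! ### Separating extensions of a valuation -/

section Separation

variable {K S Γ : Type*} [Field K] [Field S] [Algebra K S]
  [AddCommGroup Γ] [LinearOrder Γ] [IsOrderedAddMonoid Γ]

theorem val_inv_pos {w : AddValuation S (WithTop Γ)} {u : S} (hu : w u < 0) : 0 < w u⁻¹ := by
  have h0 : u ≠ 0 := by
    rintro rfl
    simp at hu
  have h : w u + w u⁻¹ = 0 := by rw [← w.map_mul, mul_inv_cancel₀ h0, w.map_one]
  by_contra hle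
  exact absurd h ((add_le_of_nonpos_right (not_lt.1 hle)).trans_lt hu).ne

theorem withTop_nsmul_pos {a : WithTop Γ} (ha : 0 < a) {n : ℕ} (hn : n ≠ 0) : 0 < n • a := by
  obtain ⟨m, rfl⟩ := Nat.exists_eq_succ_of_ne_zero hn
  rw [succ_nsmul]
  exact ha.trans_le (le_add_of_nonneg_left (nsmul_nonneg ha.le _))

/-- If two valuations extending `v` are told apart by the sign of the value of `u`, then some
polynomial expression in `u` is a unit for the first one and lies in the maximal ideal of the
second one, and it is integral for every extension of `v`. -/
theorem exists_separating_of_neg {v : AddValuation K (WithTop Γ)}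
    {w₁ w₂ : AddValuation S (WithTop Γ)} (h₁ : ∀ a, w₁ (algebraMap K S a) = v a)
    (h₂ : ∀ a, w₂ (algebraMap K S a) = v a) {u : S} (hu : IsIntegral K u)
    (hu₁ : 0 ≤ w₁ u) (hu₂ : w₂ u < 0) :
    ∃ q : K[X], w₁ (aeval u q) = 0 ∧ 0 < w₂ (aeval u q) ∧
      ∀ w : AddValuation S (WithTop Γ), (∀ a, w (algebraMap K S a) = v a) →
        0 ≤ w (aeval u q) := by
  classical
  set p := minpoly K u with hp
  have hp0 : p ≠ 0 := minpoly.ne_zero hu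
  set N := p.natDegree with hN
  let I := (Finset.range (N + 1)).filter fun i => ∀ j, v (p.coeff i) ≤ v (p.coeff j)
  have hI : I.Nonempty := by
    obtain ⟨i, hi, hmin⟩ := (Finset.range (N + 1)).exists_min_image (fun i => v (p.coeff i))
      ⟨0, by simp⟩
    refine ⟨i, Finset.mem_filter.2 ⟨hi, fun j => ?_⟩⟩
    by_cases hj : j ∈ Finset.range (N + 1)
    · exact hmin j hj
    · rw [coeff_eq_zero_of_natDegree_lt (show p.natDegree < j by rw [Finset.mem_range] at hj; omega)]
      simp
  -- The last coefficient of least value: dividing by it, the later ones lie in the maximal ideal.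
  let i := I.max' hI
  obtain ⟨hiN, himin⟩ := Finset.mem_filter.1 (I.max'_mem hI)
  have hi0 : p.coeff i ≠ 0 := by
    intro h0
    have := himin N
    rw [show p.coeff (I.max' hI) = 0 from h0, AddValuation.map_zero, top_le_iff,
      AddValuation.top_iff] at this
    exact hp0 (leadingCoeff_eq_zero.1 this)
  have hv : v (p.coeff i) ≠ ⊤ := (AddValuation.ne_top_iff v).2 hi0
  let a : ℕ → K := fun j => p.coeff j / p.coeff i
  have hmul : ∀ j, v (p.coeff j) = v (a j) + v (p.coeff i) := fun j => by
    rw [← v.map_mul, div_mul_cancel₀ _ hi0]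
  have ha : ∀ j, 0 ≤ v (a j) := fun j => by
    have h := himin j
    rw [hmul j] at h
    refine (WithTop.add_le_add_iff_right hv).1 ?_
    rw [zero_add]
    exact h
  have hai : ∀ j, i < j → 0 < v (a j) := fun j hj => by
    refine lt_of_le_of_ne (ha j) fun h0 => ?_
    have hval : v (p.coeff j) = v (p.coeff i) := by rw [hmul j, ← h0, zero_add]
    have hjN : j ∈ Finset.range (N + 1) := by
      by_contra hjN
      rw [coeff_eq_zero_of_natDegree_lt (by simpa using hjN), AddValuation.map_zero] at hval
      exact hv hval.symm
    exact absurd (I.le_max' j (Finset.mem_filter.2 ⟨hjN, fun k => hval ▸ himin k⟩)) (not_le.2 hj)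
  have ha1 : a i = 1 := div_self hi0
  let q : K[X] := ∑ k ∈ Finset.range (N + 1 - i), C (a (i + k)) * X ^ k
  have hq : aeval u q = ∑ k ∈ Finset.range (N + 1 - i), algebraMap K S (a (i + k)) * u ^ k := by
    simp [q]
  have hroot : ∑ j ∈ Finset.range (N + 1), algebraMap K S (a j) * u ^ j = 0 := by
    have h := minpoly.aeval K u
    rw [aeval_eq_sum_range] at h
    have : ∑ j ∈ Finset.range (N + 1), algebraMap K S (a j) * u ^ j =
        (algebraMap K S (p.coeff i))⁻¹ * ∑ j ∈ Finset.range (N + 1), p.coeff j • u ^ j := by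
      rw [Finset.mul_sum]
      refine Finset.sum_congr rfl fun j _ => ?_
      simp only [a, map_div₀, Algebra.smul_def]
      ring
    rw [this, h, mul_zero]
  have hiN' : i ≤ N := Nat.lt_succ_iff.1 (Finset.mem_range.1 hiN)
  have hsplit : u ^ i * aeval u q = -∑ j ∈ Finset.range i, algebraMap K S (a j) * u ^ j := by
    rw [eq_neg_iff_add_eq_zero, ← hroot, add_comm,
      ← Finset.sum_range_add_sum_Ico _ (show i ≤ N + 1 by omega), Finset.sum_Ico_eq_sum_range,
      hq, Finset.mul_sum]
    congr 1
    refine Finset.sum_congr rfl fun k _ => ?_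
    ring
  have hu0 : u ≠ 0 := by
    rintro rfl
    simp at hu₂
  have hneg : aeval u q = -∑ j ∈ Finset.range i, algebraMap K S (a j) * u⁻¹ ^ (i - j) := by
    have h : aeval u q = (u ^ i)⁻¹ * (u ^ i * aeval u q) := by
      rw [inv_mul_cancel_left₀ (pow_ne_zero _ hu0)]
    rw [h, hsplit, mul_neg, Finset.mul_sum]
    congr 1
    refine Finset.sum_congr rfl fun j hj => ?_
    have hj' : j ≤ i := (Finset.mem_range.1 hj).le
    have : (u ^ i)⁻¹ * u ^ j = u⁻¹ ^ (i - j) := by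
      rw [inv_pow, ← Nat.sub_add_cancel hj', pow_add, mul_inv, Nat.add_sub_cancel]
      rw [inv_mul_cancel_right₀ (pow_ne_zero _ hu0)]
    rw [← this]
    ring
  refine ⟨q, ?_, ?_, fun w hw => ?_⟩
  · have h : 0 < w₁ (aeval u q - 1) := by
      rw [hq, show N + 1 - i = (N - i) + 1 by omega, Finset.sum_range_succ']
      simp only [add_zero, ha1, map_one, pow_zero, mul_one, add_sub_cancel_right]
      refine w₁.map_lt_sum' (by simp) fun k _ => ?_
      rw [w₁.map_mul, h₁, w₁.map_pow]
      exact add_pos_of_pos_of_nonneg (hai _ (by omega)) (nsmul_nonneg hu₁ _)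
    rw [← w₁.map_one]
    exact w₁.map_eq_of_lt_sub (by rwa [w₁.map_one])
  · rw [hneg, AddValuation.map_neg]
    refine w₂.map_lt_sum' (by simp) fun j hj => ?_
    rw [w₂.map_mul, h₂, w₂.map_pow]
    have := Finset.mem_range.1 hj
    exact (withTop_nsmul_pos (val_inv_pos hu₂) (by omega)).trans_le (le_add_of_nonneg_left (ha _))
  · rcases le_or_gt 0 (w u) with h | h
    · rw [hq]
      refine w.map_le_sum fun k _ => ?_
      rw [w.map_mul, hw, w.map_pow]
      exact add_nonneg (ha _) (nsmul_nonneg h _)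
    · rw [hneg, AddValuation.map_neg]
      refine w.map_le_sum fun j _ => ?_
      rw [w.map_mul, hw, w.map_pow]
      exact add_nonneg (ha _) (nsmul_nonneg (val_inv_pos h).le _)

/-- Two extensions of `v` with different values at `x` are separated by an element of `K(x)`
which is integral for every extension of `v`. As all values are torsion modulo those of
`K`, dividing a power of `x` by a constant reduces this to the case where one value is zero and the
other is not. -/
theorem exists_separating {v : AddValuation K (WithTop Γ)}
    (htors : ∀ α : Γ, ∃ n : ℕ, 0 < n ∧ ∃ x : K, v x = ((n • α : Γ) : WithTop Γ))
    {w₁ w₂ : AddValuation S (WithTop Γ)} (h₁ : ∀ a, w₁ (algebraMap K S a) = v a)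
    (h₂ : ∀ a, w₂ (algebraMap K S a) = v a) [Algebra.IsIntegral K S] {x : S}
    (hx : w₁ x ≠ w₂ x) :
    ∃ s ∈ IntermediateField.adjoin K {x}, w₁ s = 0 ∧ 0 < w₂ s ∧
      ∀ w : AddValuation S (WithTop Γ), (∀ a, w (algebraMap K S a) = v a) → 0 ≤ w s := by
  have hx0 : x ≠ 0 := by
    rintro rfl
    simp at hx
  obtain ⟨α, hα⟩ := WithTop.ne_top_iff_exists.1 ((AddValuation.ne_top_iff w₁).2 hx0)
  obtain ⟨β, hβ⟩ := WithTop.ne_top_iff_exists.1 ((AddValuation.ne_top_iff w₂).2 hx0)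
  obtain ⟨n, hn, a, ha⟩ := htors α
  have ha0 : a ≠ 0 := (AddValuation.ne_top_iff v).1 (ha ▸ WithTop.coe_ne_top)
  have haS : algebraMap K S a ≠ 0 := by simpa using ha0
  have hαβ : α ≠ β := by
    rintro rfl
    exact hx (hα.symm.trans hβ)
  let u := x ^ n / algebraMap K S a
  have hu0 : u ≠ 0 := div_ne_zero (pow_ne_zero _ hx0) haS
  have hmul : u * algebraMap K S a = x ^ n := div_mul_cancel₀ _ haS
  have hu₁ : w₁ u = 0 := by
    have h := congrArg w₁ hmul
    rw [w₁.map_mul, h₁, ha, w₁.map_pow, ← hα, ← WithTop.coe_nsmul] at h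
    exact (WithTop.add_right_inj (WithTop.coe_ne_top (a := n • α))).1 (by rw [h, zero_add])
  have hu₂ : w₂ u ≠ 0 := by
    intro h0
    have h := congrArg w₂ hmul
    rw [w₂.map_mul, h₂, ha, w₂.map_pow, ← hβ, ← WithTop.coe_nsmul, h0, zero_add,
      WithTop.coe_inj] at h
    exact hαβ (nsmul_right_injective hn.ne' h)
  have hmem : u ∈ IntermediateField.adjoin K {x} :=
    div_mem (pow_mem (IntermediateField.mem_adjoin_simple_self K x) n)
      (IntermediateField.algebraMap_mem _ a)
  have key : ∀ u' ∈ IntermediateField.adjoin K {x}, 0 ≤ w₁ u' → w₂ u' < 0 →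
      ∃ s ∈ IntermediateField.adjoin K {x}, w₁ s = 0 ∧ 0 < w₂ s ∧
      ∀ w : AddValuation S (WithTop Γ), (∀ a, w (algebraMap K S a) = v a) → 0 ≤ w s := by
    intro u' hu' hp hn'
    obtain ⟨q, hq⟩ := exists_separating_of_neg h₁ h₂ (Algebra.IsIntegral.isIntegral u') hp hn'
    refine ⟨aeval u' q, ?_, hq⟩
    rw [aeval_eq_sum_range]
    exact sum_mem fun i _ => IntermediateField.smul_mem _ (pow_mem hu' i)
  rcases lt_or_gt_of_ne hu₂ with h | h
  · exact key u hmem hu₁.ge h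
  · refine key u⁻¹ (inv_mem hmem) ?_ ?_
    · rw [AddValuation.map_inv, hu₁]; simp
    · by_contra hle
      have h' := add_pos_of_pos_of_nonneg h (not_lt.1 hle)
      rw [← w₂.map_mul, mul_inv_cancel₀ hu0, w₂.map_one] at h'
      exact lt_irrefl _ h'

end Separation

/-! ### Conjugacy of extensions -/

section Conjugacy

variable {K : Type*} (S : Type*) {Γ : Type*} [Field K] [Field S] [Algebra K S]
  [AddCommGroup Γ] [LinearOrder Γ] [IsOrderedAddMonoid Γ]

/-- The elements of `S` of nonnegative value for every extension of `v` to `S`, that is, the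
integral closure of the valuation ring of `v`. -/
def extensionRing (v : AddValuation K (WithTop Γ)) : Subring S where
  carrier := {x | ∀ w : AddValuation S (WithTop Γ), (∀ a, w (algebraMap K S a) = v a) → 0 ≤ w x}
  zero_mem' := fun w _ => by simp
  one_mem' := fun w _ => by simp
  add_mem' := fun hx hy w hw => w.map_le_add (hx w hw) (hy w hw)
  neg_mem' := fun hx w hw => by rw [AddValuation.map_neg]; exact hx w hw
  mul_mem' := fun hx hy w hw => by rw [w.map_mul]; exact add_nonneg (hx w hw) (hy w hw)

variable {S}

/-- The prime ideal of `extensionRing S v` cut out by the maximal ideal of an extension `w`. -/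
def centre (v : AddValuation K (WithTop Γ)) (w : AddValuation S (WithTop Γ))
    (hw : ∀ a, w (algebraMap K S a) = v a) : Ideal (extensionRing S v) where
  carrier := {b | 0 < w b}
  zero_mem' := by simp
  add_mem' := fun hx hy => w.map_lt_add hx hy
  smul_mem' := fun c x hx => by
    change 0 < w (c.1 * x.1)
    rw [w.map_mul]
    exact lt_of_lt_of_le hx (le_add_of_nonneg_left (c.2 w hw))

theorem centre_isPrime (v : AddValuation K (WithTop Γ)) (w : AddValuation S (WithTop Γ))
    (hw : ∀ a, w (algebraMap K S a) = v a) : (centre v w hw).IsPrime := by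
  refine ⟨fun h => ?_, fun {x y} hxy => ?_⟩
  · have h1 : (1 : extensionRing S v) ∈ centre v w hw := h ▸ Submodule.mem_top
    have h2 : 0 < w (1 : S) := h1
    simp at h2
  · by_contra! hne
    have hx : w x.1 = 0 := le_antisymm (not_lt.1 hne.1) (x.2 w hw)
    have hy : w y.1 = 0 := le_antisymm (not_lt.1 hne.2) (y.2 w hw)
    have h2 : 0 < w (x.1 * y.1) := hxy
    simp [w.map_mul, hx, hy] at h2

/-- The composite of a valuation with an automorphism. -/
abbrev conjVal (w : AddValuation S (WithTop Γ)) (σ : S ≃ₐ[K] S) : AddValuation S (WithTop Γ) :=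
  w.comap (σ : S →+* S)

theorem conjVal_algebraMap {v : AddValuation K (WithTop Γ)} {w : AddValuation S (WithTop Γ)}
    (hw : ∀ a, w (algebraMap K S a) = v a) (σ : S ≃ₐ[K] S) (a : K) :
    conjVal w σ (algebraMap K S a) = v a := by
  change w (σ (algebraMap K S a)) = v a
  rw [σ.commutes, hw]

/-- Two extensions of `v` to a Galois extension `S` that agree on an intermediate field `M` are
conjugate over `M`. -/
theorem exists_conj_of_agree [IsGalois K S] {v : AddValuation K (WithTop Γ)}
    (htors : ∀ α : Γ, ∃ n : ℕ, 0 < n ∧ ∃ x : K, v x = ((n • α : Γ) : WithTop Γ))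
    {w₁ w₂ : AddValuation S (WithTop Γ)} (h₁ : ∀ a, w₁ (algebraMap K S a) = v a)
    (h₂ : ∀ a, w₂ (algebraMap K S a) = v a) (M : IntermediateField K S)
    (hM : ∀ x ∈ M, w₁ x = w₂ x) :
    ∃ τ : S ≃ₐ[M] S, ∀ x, w₂ x = w₁ (τ x) := by
  let B := extensionRing S v
  have : IsInvariantSubring (S ≃ₐ[M] S) B := ⟨fun g x hx w hw =>
    hx (conjVal w (g.restrictScalars K)) (conjVal_algebraMap hw _)⟩
  let A : Subring M := B.comap (algebraMap M S)
  let : Algebra A B :=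
    (((algebraMap M S).comp A.subtype).codRestrict B fun a => a.2).toAlgebra
  have halg : ∀ a : A, ((algebraMap A B a : B) : S) = algebraMap M S a := fun a => rfl
  have : SMulCommClass (S ≃ₐ[M] S) A B := ⟨fun g a b => by
    apply Subtype.ext
    change g ((algebraMap A B a : B) * (b : S)) = (algebraMap A B a : B) * g (b : S)
    rw [halg, map_mul, g.commutes]⟩
  let : TopologicalSpace B := ⊥
  have : DiscreteTopology B := ⟨rfl⟩
  have : ContinuousSMul (S ≃ₐ[M] S) B := by
    rw [continuousSMul_iff_stabilizer_isOpen]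
    intro b
    convert stabilizer_isOpen_of_isIntegral (K := M) (b : S) using 1
    ext g
    exact Subtype.ext_iff
  have : Algebra.IsInvariant A B (S ≃ₐ[M] S) := ⟨fun b hb => by
    obtain ⟨y, hy⟩ := (InfiniteGalois.mem_range_algebraMap_iff_fixed (k := M) (K := S) (b : S)).2
      fun g => congrArg Subtype.val (hb g)
    exact ⟨⟨y, show algebraMap M S y ∈ B from hy ▸ b.2⟩, Subtype.ext hy⟩⟩
  have := centre_isPrime v w₁ h₁
  have := centre_isPrime v w₂ h₂
  obtain ⟨g, hg⟩ := Algebra.IsInvariant.exists_smul_of_under_eq_of_profinite (A := A)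
    (G := S ≃ₐ[M] S) (centre v w₁ h₁) (centre v w₂ h₂) (by
      ext a
      change 0 < w₁ (algebraMap M S a) ↔ 0 < w₂ (algebraMap M S a)
      exact (hM _ (a : M).2) ▸ Iff.rfl)
  refine ⟨g⁻¹, fun x => ?_⟩
  by_contra hne
  obtain ⟨s, -, hs₂, hs₁, hs⟩ := exists_separating htors h₂
    (conjVal_algebraMap h₁ ((g⁻¹ : S ≃ₐ[M] S).restrictScalars K)) hne
  have hmem : (⟨s, hs⟩ : B) ∈ centre v w₂ h₂ := by
    rw [hg, Ideal.mem_pointwise_smul_iff_inv_smul_mem]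
    exact hs₁
  have : 0 < w₂ s := hmem
  exact this.ne' hs₂

theorem eq_on_adjoin_of_eq {c : S} {σ τ : S ≃ₐ[K] S} (h : σ c = τ c) {x : S}
    (hx : x ∈ IntermediateField.adjoin K {c}) : σ x = τ x := by
  induction hx using IntermediateField.adjoin_induction with
  | mem x hx =>
    rw [Set.mem_singleton_iff] at hx
    rw [hx, h]
  | algebraMap a => rw [σ.commutes, τ.commutes]
  | add x y _ _ hx hy => rw [map_add, map_add, hx, hy]
  | inv x _ hx => rw [map_inv₀, map_inv₀, hx]
  | mul x y _ _ hx hy => rw [map_mul, map_mul, hx, hy]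

theorem exists_separating_conj [IsGalois K S] {v : AddValuation K (WithTop Γ)}
    (htors : ∀ α : Γ, ∃ n : ℕ, 0 < n ∧ ∃ x : K, v x = ((n • α : Γ) : WithTop Γ))
    {w : AddValuation S (WithTop Γ)} (hw : ∀ a, w (algebraMap K S a) = v a) {c : S}
    (hc : ∀ σ : S ≃ₐ[K] S, (∀ x, w (σ x) = w x) → σ c = c) {σ : S ≃ₐ[K] S} (hσ : σ c ≠ c) :
    ∃ s ∈ IntermediateField.adjoin K {c}, w s = 0 ∧ 0 < w (σ s) ∧
      s ∈ extensionRing S v := by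
  by_cases hM : ∀ x ∈ IntermediateField.adjoin K {c}, w x = conjVal w σ x
  · obtain ⟨τ, hτ⟩ := exists_conj_of_agree htors hw (conjVal_algebraMap hw σ) _ hM
    have hτc : τ.symm c = c := by
      have := τ.symm.commutes ⟨c, IntermediateField.mem_adjoin_simple_self K c⟩
      exact this
    have := hc ((τ.symm.restrictScalars K).trans σ) fun x => by
      have h := hτ (τ.symm x)
      rw [τ.apply_symm_apply] at h
      exact h
    change σ (τ.symm c) = c at this
    rw [hτc] at this
    exact absurd this hσ
  · push Not at hM
    obtain ⟨x, hx, hne⟩ := hM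
    obtain ⟨s, hs, h1, h2, h3⟩ := exists_separating htors hw (conjVal_algebraMap hw σ) hne
    exact ⟨s, IntermediateField.adjoin_simple_le_iff.2 hx hs, h1, h2, h3⟩

/-- An element of `K(c)` that is a unit for `w` and lies in the maximal ideal of `w ∘ σ` for
all `σ` moving `c`. -/
theorem exists_isolating [IsGalois K S] {v : AddValuation K (WithTop Γ)}
    (htors : ∀ α : Γ, ∃ n : ℕ, 0 < n ∧ ∃ x : K, v x = ((n • α : Γ) : WithTop Γ))
    {w : AddValuation S (WithTop Γ)} (hw : ∀ a, w (algebraMap K S a) = v a) {c : S}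
    (hc : ∀ σ : S ≃ₐ[K] S, (∀ x, w (σ x) = w x) → σ c = c) :
    ∃ a ∈ IntermediateField.adjoin K {c}, w a = 0 ∧
      ∀ σ : S ≃ₐ[K] S, σ c ≠ c → 0 < w (σ a) := by
  classical
  have H : ∀ β : S, ∃ s ∈ IntermediateField.adjoin K {c}, w s = 0 ∧ s ∈ extensionRing S v ∧
      ∀ σ : S ≃ₐ[K] S, σ c = β → σ c ≠ c → 0 < w (σ s) := by
    intro β
    by_cases h : ∃ σ : S ≃ₐ[K] S, σ c = β ∧ σ c ≠ c
    · obtain ⟨σ, hσ, hne⟩ := h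
      obtain ⟨s, hs, h1, h2, h3⟩ := exists_separating_conj htors hw hc hne
      refine ⟨s, hs, h1, h3, fun τ hτ _ => ?_⟩
      rwa [eq_on_adjoin_of_eq (hτ.trans hσ.symm) hs]
    · push Not at h
      exact ⟨1, one_mem _, w.map_one, one_mem _, fun σ h1 h2 => absurd (h σ h1) h2⟩
  choose s hsM hs0 hsB hsσ using H
  let R := ((minpoly K c).aroots S).toFinset
  have hR : ∀ σ : S ≃ₐ[K] S, σ c ∈ R := fun σ => by
    rw [Multiset.mem_toFinset, mem_aroots]
    refine ⟨minpoly.ne_zero (Algebra.IsIntegral.isIntegral c), ?_⟩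
    rw [aeval_algEquiv, AlgHom.comp_apply, minpoly.aeval, map_zero]
  have hprod : ∀ (w' : AddValuation S (WithTop Γ)) (T : Finset S),
      w' (∏ β ∈ T, s β) = ∑ β ∈ T, w' (s β) := fun w' T => by
    induction T using Finset.induction_on with
    | empty => simp
    | insert b T hb ih => rw [Finset.prod_insert hb, w'.map_mul, ih, Finset.sum_insert hb]
  refine ⟨∏ β ∈ R, s β, prod_mem fun β _ => hsM β, ?_, fun σ hσ => ?_⟩
  · rw [hprod]
    exact Finset.sum_eq_zero fun β _ => hs0 β
  · change 0 < conjVal w σ (∏ β ∈ R, s β)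
    rw [hprod, ← Finset.add_sum_erase _ _ (hR σ)]
    exact add_pos_of_pos_of_nonneg (hsσ (σ c) σ rfl hσ)
      (Finset.sum_nonneg fun β _ => hsB β _ (conjVal_algebraMap hw σ))

end Conjugacy

/-! ### The henselization is immediate -/

section Immediate

variable {K S Γ : Type*} [Field K] [Field S] [Algebra K S]
  [AddCommGroup Γ] [LinearOrder Γ] [IsOrderedAddMonoid Γ]

/-- If no root `β` of `∏ (aX - β)` has the value of `a`, one coefficient has the least value. -/
theorem exists_dominant_coeff (w : AddValuation S (WithTop Γ)) {a : S} (ha : a ≠ 0)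
    (T : Multiset S) (hT : ∀ β ∈ T, w β ≠ w a) :
    ∃ h : ℕ, w ((T.map fun β => C a * X - C β).prod.coeff h) ≠ ⊤ ∧
      ∀ j ≠ h, w ((T.map fun β => C a * X - C β).prod.coeff h) <
        w ((T.map fun β => C a * X - C β).prod.coeff j) := by
  have ha' : w a ≠ ⊤ := (AddValuation.ne_top_iff w).2 ha
  induction T using Multiset.induction_on with
  | empty =>
    refine ⟨0, by simp, fun j hj => ?_⟩
    simp [coeff_one, hj]
  | cons b T ih =>
    obtain ⟨h, htop, hlt⟩ := ih fun β hβ => hT β (Multiset.mem_cons_of_mem hβ)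
    set f := (T.map fun β => C a * X - C β).prod with hf
    have hmul : ((b ::ₘ T).map fun β => C a * X - C β).prod = C a * (X * f) - C b * f := by
      rw [Multiset.map_cons, Multiset.prod_cons, ← hf]
      ring
    rw [hmul]
    have h0 : (C a * (X * f) - C b * f).coeff 0 = -(b * f.coeff 0) := by simp
    have hs : ∀ j, (C a * (X * f) - C b * f).coeff (j + 1) =
        a * f.coeff j - b * f.coeff (j + 1) := fun j => by
      simp [coeff_X_mul]
    have hle : ∀ j, w (f.coeff h) ≤ w (f.coeff j) := fun j => by
      rcases eq_or_ne j h with rfl | hj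
      · exact le_rfl
      · exact (hlt j hj).le
    rcases lt_or_gt_of_ne (hT b (Multiset.mem_cons_self b T)) with hb | hb
    · -- The term `-β` dominates.
      have hb' : w b ≠ ⊤ := ne_top_of_lt hb
      have ha_lt : ∀ j, w (b * f.coeff h) < w (a * f.coeff j) := fun j => by
        rw [w.map_mul, w.map_mul]
        exact (WithTop.add_lt_add_right htop hb).trans_le (add_le_add_right (hle j) _)
      have hb_lt : ∀ j ≠ h, w (b * f.coeff h) < w (b * f.coeff j) := fun j hj => by
        rw [w.map_mul, w.map_mul]
        exact WithTop.add_lt_add_left hb' (hlt j hj)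
      have hval : w ((C a * (X * f) - C b * f).coeff h) = w (b * f.coeff h) := by
        cases h with
        | zero => rw [h0, AddValuation.map_neg]
        | succ h => rw [hs, w.map_sub_eq_of_lt_right (ha_lt h)]
      refine ⟨h, ?_, fun j hj => ?_⟩
      · rw [hval, w.map_mul]
        exact WithTop.add_ne_top.2 ⟨hb', htop⟩
      · rw [hval]
        cases j with
        | zero => rw [h0, AddValuation.map_neg]; exact hb_lt _ hj
        | succ j =>
          rw [hs, sub_eq_add_neg]
          refine w.map_lt_add (ha_lt j) ?_
          rw [AddValuation.map_neg]
          exact hb_lt _ hj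
    · -- The term `aX` dominates.
      have hb_lt : ∀ j, w (a * f.coeff h) < w (b * f.coeff j) := fun j => by
        rw [w.map_mul, w.map_mul]
        exact (WithTop.add_lt_add_right htop hb).trans_le (add_le_add_right (hle j) _)
      have ha_lt : ∀ j ≠ h, w (a * f.coeff h) < w (a * f.coeff j) := fun j hj => by
        rw [w.map_mul, w.map_mul]
        exact WithTop.add_lt_add_left ha' (hlt j hj)
      have hval : w ((C a * (X * f) - C b * f).coeff (h + 1)) = w (a * f.coeff h) := by
        rw [hs, w.map_sub_eq_of_lt_left (hb_lt _)]
      refine ⟨h + 1, ?_, fun j hj => ?_⟩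
      · rw [hval, w.map_mul]
        exact WithTop.add_ne_top.2 ⟨ha', htop⟩
      · rw [hval]
        cases j with
        | zero => rw [h0, AddValuation.map_neg]; exact hb_lt _
        | succ j =>
          rw [hs, sub_eq_add_neg]
          refine w.map_lt_add (ha_lt j fun h' => hj (h' ▸ rfl)) ?_
          rw [AddValuation.map_neg]
          exact hb_lt _

/-- If no other conjugate of `a` has the value of `a`, then `a` agrees to first order with the
negative quotient of two consecutive coefficients of its minimal polynomial. -/
theorem exists_approx_of_isolated [IsGalois K S] (w : AddValuation S (WithTop Γ)) {a : S}
    (ha : a ≠ 0) (hiso : ∀ σ : S ≃ₐ[K] S, σ a ≠ a → w (σ a) ≠ w a) :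
    ∃ k : K, w a < w (a - algebraMap K S k) := by
  classical
  have hint : IsIntegral K a := Algebra.IsIntegral.isIntegral a
  have ha' : w a ≠ ⊤ := (AddValuation.ne_top_iff w).2 ha
  let p := (minpoly K a).map (algebraMap K S)
  have hp0 : p ≠ 0 := ((minpoly.monic hint).map _).ne_zero
  have hsplit : p.Splits := Normal.splits inferInstance a
  have hroot : a ∈ p.roots := by
    rw [mem_roots hp0, IsRoot.def, eval_map_algebraMap, minpoly.aeval]
  have hnodup : p.roots.Nodup :=
    nodup_roots (Separable.map (Algebra.IsSeparable.isSeparable K a))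
  obtain ⟨T, hT⟩ := Multiset.exists_cons_of_mem hroot
  have hprod : p = (X - C a) * (T.map fun β => X - C β).prod := by
    have h := hsplit.eq_prod_roots_of_monic ((minpoly.monic hint).map _)
    rw [hT, Multiset.map_cons, Multiset.prod_cons] at h
    exact h
  have hval : ∀ β ∈ T, w β ≠ w a := fun β hβ => by
    have hβa : β ≠ a := by
      rintro rfl
      rw [hT] at hnodup
      exact (Multiset.nodup_cons.1 hnodup).1 hβ
    have hβ' : β ∈ p.roots := hT ▸ Multiset.mem_cons_of_mem hβ
    rw [mem_roots hp0, IsRoot.def, eval_map_algebraMap] at hβ'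
    obtain ⟨σ, hσ⟩ := minpoly.exists_algEquiv_of_root' (x := β) (y := a) hint.isAlgebraic hβ'
    rw [← hσ] at hβa ⊢
    exact hiso σ hβa
  obtain ⟨h, htop, hlt⟩ := exists_dominant_coeff w ha T hval
  set f := (T.map fun β => C a * X - C β).prod with hf
  have hcomp : p.comp (C a * X) = C a * (X * f) - C a * f := by
    rw [hprod, mul_comp, multiset_prod_comp, Multiset.map_map]
    have : ((fun q : S[X] => q.comp (C a * X)) ∘ fun β => X - C β) =
        fun β => C a * X - C β := by
      funext β
      simp
    rw [this, ← hf]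
    simp only [sub_comp, X_comp, C_comp]
    ring
  have hcoeff : ∀ j, (p.comp (C a * X)).coeff j = p.coeff j * a ^ j := fun j => by
    rw [comp_C_mul_X_coeff]
  -- With `X` scaled by `a`, the two consecutive coefficients are equal and opposite to first
  -- order, and the lower one is dominated by neither of its neighbours.
  have hhi : p.coeff (h + 1) * a ^ (h + 1) = a * (f.coeff h - f.coeff (h + 1)) := by
    rw [← hcoeff, hcomp]
    simp [coeff_X_mul, mul_sub]
  have hhi_val : w (p.coeff (h + 1) * a ^ (h + 1)) = w (a * f.coeff h) := by
    rw [hhi, w.map_mul, w.map_mul, w.map_sub_eq_of_lt_left (hlt _ (by omega))]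
  have hsum : w (a * f.coeff h) <
      w (p.coeff h * a ^ h + p.coeff (h + 1) * a ^ (h + 1)) := by
    have hsub : ∀ g : S, w (f.coeff h) < w g →
        w (a * f.coeff h) < w (a * (g - f.coeff (h + 1))) := fun g hg => by
      rw [w.map_mul, w.map_mul]
      refine WithTop.add_lt_add_left ha' ?_
      rw [sub_eq_add_neg]
      refine w.map_lt_add hg ?_
      rw [AddValuation.map_neg]
      exact hlt _ (by omega)
    rw [hhi, ← hcoeff, hcomp]
    cases h with
    | zero =>
      have := hsub 0 (by simpa using htop.lt_top)
      convert this using 2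
      simp
      ring
    | succ h =>
      have := hsub (f.coeff h) (hlt _ (by omega))
      convert this using 2
      simp [coeff_X_mul]
      ring
  have htop' : w (a * f.coeff h) ≠ ⊤ := by
    rw [w.map_mul]
    exact WithTop.add_ne_top.2 ⟨ha', htop⟩
  have hne : p.coeff (h + 1) ≠ 0 := by
    intro h0
    rw [h0, zero_mul, w.map_zero] at hhi_val
    exact htop' hhi_val.symm
  refine ⟨-((minpoly K a).coeff h / (minpoly K a).coeff (h + 1)), ?_⟩
  have hk : (a - algebraMap K S (-((minpoly K a).coeff h / (minpoly K a).coeff (h + 1)))) *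
      (p.coeff (h + 1) * a ^ h) = p.coeff h * a ^ h + p.coeff (h + 1) * a ^ (h + 1) := by
    have h1 : algebraMap K S ((minpoly K a).coeff h) = p.coeff h := (coeff_map _ _).symm
    have h2 : algebraMap K S ((minpoly K a).coeff (h + 1)) = p.coeff (h + 1) :=
      (coeff_map _ _).symm
    rw [map_neg, map_div₀, h1, h2]
    field_simp
    ring
  have hmul : p.coeff (h + 1) * a ^ (h + 1) = a * (p.coeff (h + 1) * a ^ h) := by ring
  have hfin : w (p.coeff (h + 1) * a ^ h) ≠ ⊤ :=
    (AddValuation.ne_top_iff w).2 (mul_ne_zero hne (pow_ne_zero _ ha))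
  rw [← hhi_val, ← hk, hmul, w.map_mul a, w.map_mul (a - _)] at hsum
  exact (WithTop.add_lt_add_iff_right hfin).1 hsum

/-- An element fixed by the decomposition group of `w` agrees to first order with an element
of `K`. -/
theorem exists_approx_of_fixed [IsGalois K S] {v : AddValuation K (WithTop Γ)}
    (htors : ∀ α : Γ, ∃ n : ℕ, 0 < n ∧ ∃ x : K, v x = ((n • α : Γ) : WithTop Γ))
    {w : AddValuation S (WithTop Γ)} (hw : ∀ a, w (algebraMap K S a) = v a) {c : S}
    (hc : ∀ σ : S ≃ₐ[K] S, (∀ x, w (σ x) = w x) → σ c = c) (hc0 : c ≠ 0) :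
    ∃ k : K, w c < w (c - algebraMap K S k) := by
  classical
  obtain ⟨a, haM, ha, hpos⟩ := exists_isolating htors hw hc
  have ha0 : a ≠ 0 := by
    rintro rfl
    simp at ha
  have hwa : ∀ n : ℕ, w (a ^ n) = 0 := fun n => by rw [w.map_pow, ha, smul_zero]
  have hcM := IntermediateField.mem_adjoin_simple_self K c
  let R := ((minpoly K c).aroots S).toFinset
  have hR : ∀ σ : S ≃ₐ[K] S, σ c ∈ R := fun σ => by
    rw [Multiset.mem_toFinset, mem_aroots]
    refine ⟨minpoly.ne_zero (Algebra.IsIntegral.isIntegral c), ?_⟩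
    rw [aeval_algEquiv, AlgHom.comp_apply, minpoly.aeval, map_zero]
  -- Each conjugate of `c` excludes at most one exponent.
  let bad : S → Set ℕ := fun β =>
    {n | ∃ σ : S ≃ₐ[K] S, σ c = β ∧ σ c ≠ c ∧ w (σ (c * a ^ n)) = w (c * a ^ n)}
  have hbad : ∀ β, (bad β).Subsingleton := by
    rintro β n ⟨σ, hσ, hne, h1⟩ m ⟨τ, hτ, -, h2⟩
    rw [map_mul, map_pow, ← eq_on_adjoin_of_eq (hσ.trans hτ.symm) hcM,
      ← eq_on_adjoin_of_eq (hσ.trans hτ.symm) haM] at h2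
    rw [map_mul, map_pow, w.map_mul, w.map_mul, hwa, ← w.map_mul, add_zero, w.map_mul,
      w.map_pow] at h1
    rw [w.map_mul, w.map_mul, hwa, add_zero, w.map_pow, ← h1] at h2
    have hfin : w (σ c) ≠ ⊤ := (AddValuation.ne_top_iff w).2 (by simpa using hc0)
    have hfin' : w (σ a) ≠ ⊤ := (AddValuation.ne_top_iff w).2 (by simpa using ha0)
    have h3 := (WithTop.add_left_inj hfin).1 h2
    have hp := hpos σ hne
    obtain ⟨t, ht⟩ := WithTop.ne_top_iff_exists.1 hfin'
    rw [← ht, ← WithTop.coe_nsmul, ← WithTop.coe_nsmul, WithTop.coe_inj] at h3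
    rw [← ht] at hp
    exact (nsmul_left_strictMono (WithTop.coe_pos.1 hp)).injective h3.symm
  have hfinite : (⋃ β ∈ R, bad β).Finite :=
    R.finite_toSet.biUnion fun β _ => (hbad β).finite
  obtain ⟨n, hn⟩ := (hfinite.union (Set.finite_singleton 0)).exists_notMem
  rw [Set.mem_union, not_or] at hn
  have hn0 : n ≠ 0 := fun h => hn.2 h
  have hfix : ∀ (σ : S ≃ₐ[K] S), σ c = c → ∀ x ∈ IntermediateField.adjoin K {c}, σ x = x :=
    fun σ hσ x hx => eq_on_adjoin_of_eq (τ := AlgEquiv.refl) hσ hx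
  obtain ⟨k₁, hk₁⟩ := exists_approx_of_isolated (K := K) w
    (mul_ne_zero hc0 (pow_ne_zero n ha0)) fun σ hσ heq => by
      have hσc : σ c ≠ c := fun h => hσ (hfix σ h _ (mul_mem hcM (pow_mem haM n)))
      exact hn.1 (Set.mem_biUnion (hR σ) ⟨σ, rfl, hσc, heq⟩)
  obtain ⟨k₂, hk₂⟩ := exists_approx_of_isolated (K := K) w (pow_ne_zero n ha0) fun σ hσ heq => by
      have hσc : σ c ≠ c := fun h => hσ (hfix σ h _ (pow_mem haM n))
      rw [hwa, map_pow, w.map_pow] at heq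
      exact (withTop_nsmul_pos (hpos σ hσc) hn0).ne' heq
  rw [hwa] at hk₂
  rw [w.map_mul, hwa, add_zero] at hk₁
  have hk₂' : w (algebraMap K S k₂) = 0 := by
    rw [← hwa n]
    refine (w.map_eq_of_lt_sub ?_)
    rwa [hwa, w.map_sub_swap]
  have hk₂0 : algebraMap K S k₂ ≠ 0 := by
    intro h
    simp [h] at hk₂'
  refine ⟨k₁ / k₂, ?_⟩
  have hkey : (c - algebraMap K S (k₁ / k₂)) * algebraMap K S k₂ =
      (c * a ^ n - algebraMap K S k₁) - c * (a ^ n - algebraMap K S k₂) := by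
    rw [map_div₀]
    field_simp
    ring
  have hfinc : w c ≠ ⊤ := (AddValuation.ne_top_iff w).2 hc0
  have hlt : w c < w ((c - algebraMap K S (k₁ / k₂)) * algebraMap K S k₂) := by
    rw [hkey, sub_eq_add_neg]
    refine w.map_lt_add hk₁ ?_
    rw [AddValuation.map_neg, w.map_mul]
    conv_lhs => rw [← add_zero (w c)]
    exact WithTop.add_lt_add_left hfinc hk₂
  rwa [w.map_mul, hk₂', add_zero] at hlt

/-- The henselization is an immediate extension. -/
theorem henselization_exists_approx {v : AddValuation K (WithTop Γ)}
    (htors : ∀ α : Γ, ∃ n : ℕ, 0 < n ∧ ∃ x : K, v x = ((n • α : Γ) : WithTop Γ))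
    {L : Type*} [Field L] [Algebra K L] [IsAlgClosure K L] (vbar : AddValuation L (WithTop Γ))
    (hv : ∀ x : K, vbar (algebraMap K L x) = v x) {c : Henselization K vbar} (hc : c ≠ 0) :
    ∃ k : K, henselVal K vbar c < henselVal K vbar (c - algebraMap K _ k) := by
  have : Normal K L := IsAlgClosure.normal K L
  have : IsGalois K (separableClosure K L) := separableClosure.isGalois K L
  exact exists_approx_of_fixed htors
    (w := vbar.comap (algebraMap (separableClosure K L) L)) hv
    (c := (c : separableClosure K L)) (fun σ hσ => c.2 ⟨σ, hσ⟩) (by simpa using hc)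

end Immediate

/-! ### Divisibility of initial terms -/

section InitialDivisibility

variable {R Γ : Type*} [CommRing R] [AddCommGroup Γ] [LinearOrder Γ] [IsOrderedAddMonoid Γ]
  {μ : AddValuation R (WithTop Γ)}

theorem val_eq_of_lt_sub {a b : R} (h : μ a < μ (a - b)) : μ b = μ a :=
  μ.map_eq_of_lt_sub (by rwa [μ.map_sub_swap])

theorem lt_sub_symm {a b : R} (h : μ a < μ (a - b)) : μ b < μ (b - a) := by
  rwa [val_eq_of_lt_sub h, μ.map_sub_swap]

theorem lt_sub_trans {a b c : R} (hab : μ a < μ (a - b)) (hbc : μ b < μ (b - c)) :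
    μ a < μ (a - c) := by
  rw [← sub_add_sub_cancel a b c]
  exact μ.map_lt_add hab (val_eq_of_lt_sub hab ▸ hbc)

theorem lt_sub_mul_left {a b c : R} (hc : μ c ≠ ⊤) :
    μ (c * a) < μ (c * a - c * b) ↔ μ a < μ (a - b) := by
  rw [← mul_sub, μ.map_mul, μ.map_mul, WithTop.add_lt_add_iff_left hc]

theorem lt_sub_mul {a a' b b' : R} (ha : μ a < μ (a - a')) (hb : μ b < μ (b - b')) :
    μ (a * b) < μ (a * b - a' * b') := by
  refine lt_sub_trans (b := a * b') ((lt_sub_mul_left (ne_top_of_lt ha)).2 hb) ?_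
  rw [mul_comm a, mul_comm a']
  exact (lt_sub_mul_left (val_eq_of_lt_sub hb ▸ ne_top_of_lt hb)).2 ha

theorem lt_sub_prod {ι : Type*} (T : Finset ι) {a b : ι → R}
    (h : ∀ i ∈ T, μ (a i) < μ (a i - b i)) :
    μ (∏ i ∈ T, a i) < μ (∏ i ∈ T, a i - ∏ i ∈ T, b i) := by
  classical
  induction T using Finset.induction_on with
  | empty => simp
  | insert i T hi ih =>
    rw [Finset.prod_insert hi, Finset.prod_insert hi]
    exact lt_sub_mul (h i (Finset.mem_insert_self i T))
      (ih fun j hj => h j (Finset.mem_insert_of_mem hj))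

/-- The initial term of `a` divides the initial term of `b`, expressed in the ring itself: some
multiple of `a` has the same initial term as `b`. This entails that `b` has finite value. -/
def InDvd (μ : AddValuation R (WithTop Γ)) (a b : R) : Prop := ∃ c, μ b < μ (b - a * c)

theorem InDvd.ne_top {a b : R} (h : InDvd μ a b) : μ b ≠ ⊤ := by
  obtain ⟨c, hc⟩ := h
  exact ne_top_of_lt hc

theorem InDvd.congr_right {a b b' : R} (h : InDvd μ a b) (hb : μ b < μ (b - b')) :
    InDvd μ a b' := by
  obtain ⟨c, hc⟩ := h
  exact ⟨c, lt_sub_trans (lt_sub_symm hb) hc⟩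

theorem InDvd.congr_left {a a' b : R} (h : InDvd μ a b) (ha : μ a < μ (a - a')) :
    InDvd μ a' b := by
  obtain ⟨c, hc⟩ := h
  have hc' : μ c ≠ ⊤ := fun h => by
    have := val_eq_of_lt_sub hc
    rw [μ.map_mul, h, WithTop.add_top] at this
    exact ne_top_of_lt hc this.symm
  refine ⟨c, lt_sub_trans hc ?_⟩
  rw [mul_comm a, mul_comm a']
  exact (lt_sub_mul_left hc').2 ha

theorem inDvd_of_dvd {a b : R} (hb : μ b ≠ ⊤) (h : a ∣ b) : InDvd μ a b := by
  obtain ⟨c, rfl⟩ := h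
  exact ⟨c, by rw [sub_self, μ.map_zero]; exact hb.lt_top⟩

theorem InDvd.of_mul_left {a b c : R} (h : InDvd μ (a * c) b) : InDvd μ a b := by
  obtain ⟨x, hx⟩ := h
  exact ⟨c * x, by rwa [← mul_assoc]⟩

theorem inDvd_mul_left_iff {a b c : R} (hc : μ c ≠ ⊤) :
    InDvd μ (c * a) (c * b) ↔ InDvd μ a b := by
  refine exists_congr fun x => ?_
  rw [mul_assoc, lt_sub_mul_left hc]

/-- Euclid's lemma for the initial term of `p`. -/
def InPrime (μ : AddValuation R (WithTop Γ)) (p : R) : Prop :=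
  ∀ x y, InDvd μ p (x * y) → InDvd μ p x ∨ InDvd μ p y

/-- The initial term of `b` is not a zero divisor modulo the initial term of `a`. -/
def InCoprime (μ : AddValuation R (WithTop Γ)) (a b : R) : Prop :=
  ∀ x, InDvd μ a (x * b) → InDvd μ a x

theorem inCoprime_one (a : R) : InCoprime μ a 1 := fun x h => by rwa [mul_one] at h

theorem InCoprime.mul {a b c : R} (hb : InCoprime μ a b) (hc : InCoprime μ a c) :
    InCoprime μ a (b * c) := fun x h => hb x (hc (x * b) (by rwa [mul_assoc]))

theorem InCoprime.pow {a b : R} (hb : InCoprime μ a b) (n : ℕ) : InCoprime μ a (b ^ n) := by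
  induction n with
  | zero => rw [pow_zero]; exact inCoprime_one a
  | succ n ih => rw [pow_succ]; exact ih.mul hb

theorem InCoprime.prod {ι : Type*} (T : Finset ι) {a : R} {b : ι → R}
    (h : ∀ i ∈ T, InCoprime μ a (b i)) : InCoprime μ a (∏ i ∈ T, b i) := by
  classical
  induction T using Finset.induction_on with
  | empty => rw [Finset.prod_empty]; exact inCoprime_one a
  | insert i T hi ih =>
    rw [Finset.prod_insert hi]
    exact (h i (Finset.mem_insert_self i T)).mul
      (ih fun j hj => h j (Finset.mem_insert_of_mem hj))

theorem InCoprime.congr_left {a a' b : R} (h : InCoprime μ a b) (ha : μ a < μ (a - a')) :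
    InCoprime μ a' b := fun x hx => (h x (hx.congr_left (lt_sub_symm ha))).congr_left ha

theorem InCoprime.congr_right {a b b' : R} (h : InCoprime μ a b) (hb : μ b < μ (b - b')) :
    InCoprime μ a b' := fun x hx => by
  have hx' : μ x ≠ ⊤ := fun h => hx.ne_top (by rw [μ.map_mul, h, WithTop.top_add])
  exact h x (hx.congr_right ((lt_sub_mul_left hx').2 (lt_sub_symm hb)))

theorem InPrime.pow_inCoprime {p b : R} (hp : InPrime μ p) (hb : ¬ InDvd μ p b) (n : ℕ) :
    InCoprime μ (p ^ n) b := by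
  induction n with
  | zero =>
    intro x h
    rw [pow_zero]
    exact inDvd_of_dvd (fun hx => h.ne_top (by rw [μ.map_mul, hx, WithTop.top_add])) (one_dvd x)
  | succ n ih =>
    intro x h
    rw [pow_succ'] at h ⊢
    obtain ⟨y, hy⟩ := (hp x b h.of_mul_left).resolve_right hb
    have hb' : μ b ≠ ⊤ := fun hb' => h.ne_top (by rw [μ.map_mul, hb', WithTop.add_top])
    have hp' : μ p ≠ ⊤ := fun hp' => by
      have := val_eq_of_lt_sub hy
      rw [μ.map_mul, hp', WithTop.top_add] at this
      exact ne_top_of_lt hy this.symm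
    have h1 : μ (x * b) < μ (x * b - p * (y * b)) := by
      rw [← mul_assoc, mul_comm x, mul_comm (p * y)]
      exact (lt_sub_mul_left hb').2 hy
    have h2 := ih y ((inDvd_mul_left_iff hp').1 (h.congr_right h1))
    exact ((inDvd_mul_left_iff hp').2 h2).congr_right (lt_sub_symm hy)

theorem InPrime.inCoprime_right {p a : R} (hp : InPrime μ p) (ha : ¬ InDvd μ p a) :
    InCoprime μ a p := by
  rintro x ⟨c, hc⟩
  have htop : μ (a * c) ≠ ⊤ := val_eq_of_lt_sub hc ▸ ne_top_of_lt hc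
  have ha' : μ a ≠ ⊤ := fun h => htop (by rw [μ.map_mul, h, WithTop.top_add])
  have hp' : μ p ≠ ⊤ := fun h => ne_top_of_lt hc (by rw [μ.map_mul, h, WithTop.add_top])
  have h1 : InDvd μ p (a * c) := ⟨x, by rw [mul_comm p]; exact lt_sub_symm hc⟩
  obtain ⟨y, hy⟩ := (hp a c h1).resolve_left ha
  refine ⟨y, (lt_sub_mul_left hp').1 (lt_sub_trans (b := a * c) ?_ ?_)⟩
  · rwa [mul_comm p]
  · rw [mul_left_comm p]
    exact (lt_sub_mul_left ha').2 hy

theorem InPrime.not_inDvd_pow {p a : R} (hp : InPrime μ p) (h1 : ¬ InDvd μ p 1)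
    (ha : ¬ InDvd μ p a) (n : ℕ) : ¬ InDvd μ p (a ^ n) := by
  induction n with
  | zero => rwa [pow_zero]
  | succ n ih =>
    rw [pow_succ]
    exact fun h => (hp _ _ h).elim ih ha

end InitialDivisibility

section Minimality

variable {K Γ : Type*} [Field K] [AddCommGroup Γ] [LinearOrder Γ] [IsOrderedAddMonoid Γ]
  {μ : AddValuation K[X] (WithTop Γ)}

/-- `φ` is `μ`-minimal: its initial term divides that of no nonzero polynomial of smaller
degree. -/
def InMinimal (μ : AddValuation K[X] (WithTop Γ)) (φ : K[X]) : Prop :=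
  ∀ a : K[X], a ≠ 0 → a.natDegree < φ.natDegree → ¬ InDvd μ φ a

theorem InMinimal.val_add_mul_le {φ : K[X]} (h : InMinimal μ φ) {a : K[X]}
    (ha : a.degree < φ.degree) (c : K[X]) : μ (a + φ * c) ≤ μ a := by
  rcases eq_or_ne a 0 with rfl | ha0
  · simp
  · by_contra hlt
    exact h a ha0 (natDegree_lt_natDegree ha0 ha) ⟨-c, by simpa using hlt⟩

/-- The lowest term of the `φ`-expansion of `b` that has the value of `b` obstructs
divisibility of initial terms by a power of `φ` beyond the degree of `b`. -/
theorem InMinimal.not_inDvd_pow {φ : K[X]} (hm : φ.Monic) (h : InMinimal μ φ)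
    (hφ : μ φ ≠ ⊤) (n : ℕ) : ∀ b : K[X], b.degree < (φ ^ n).degree → ¬ InDvd μ (φ ^ n) b := by
  induction n with
  | zero =>
    intro b hb hd
    rw [pow_zero, degree_one, Nat.WithBot.lt_zero_iff, degree_eq_bot] at hb
    exact hd.ne_top (by rw [hb, μ.map_zero])
  | succ n ih =>
    rintro b hb ⟨c, hc⟩
    have hdiv : b %ₘ φ + φ * (b /ₘ φ) = b := modByMonic_add_div b φ
    have hdeg : (b %ₘ φ).degree < φ.degree := degree_modByMonic_lt b hm
    have h1 : μ (b - φ ^ (n + 1) * c) ≤ μ (b %ₘ φ) := by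
      refine le_trans (le_of_eq ?_) (h.val_add_mul_le hdeg (b /ₘ φ - φ ^ n * c))
      congr 1
      conv_lhs => rw [← hdiv]
      ring
    have h2 : μ b < μ (b - φ * (b /ₘ φ)) := by
      rw [show b - φ * (b /ₘ φ) = b %ₘ φ by rw [modByMonic_eq_sub_mul_div]]
      exact hc.trans_le h1
    have h3 : InDvd μ (φ * φ ^ n) (φ * (b /ₘ φ)) := by
      rw [← pow_succ']
      exact InDvd.congr_right ⟨c, hc⟩ h2
    refine ih _ ?_ ((inDvd_mul_left_iff hφ).1 h3)
    by_cases hb0 : b /ₘ φ = 0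
    · rw [hb0, degree_zero, bot_lt_iff_ne_bot, Ne, degree_eq_bot]
      exact (hm.pow n).ne_zero
    · have hle : φ.degree ≤ b.degree := by
        by_contra hlt
        exact hb0 ((divByMonic_eq_zero_iff hm).2 (not_le.1 hlt))
      have := degree_add_divByMonic hm hle
      rw [pow_succ', degree_mul, ← this] at hb
      exact lt_of_add_lt_add_left hb

end Minimality

/-! ### Initial terms in the graded algebra -/

section InitialTerms

universe u v

variable {K : Type u} {Γ : Type v} [Field K] [AddCommGroup Γ] [LinearOrder Γ]
  [IsOrderedAddMonoid Γ] {μ : AddValuation K[X] (WithTop Γ)}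

theorem inTerm_of_top {f : K[X]} (hf : μ f = ⊤) : inTerm μ f = 0 := dif_pos hf

theorem inTerm_of_coe {f : K[X]} {α : Γ} (hf : μ f = α) : inTerm μ f = cls μ α f hf.ge := by
  have h : μ f ≠ ⊤ := hf ▸ WithTop.coe_ne_top
  rw [inTerm, dif_neg h]
  have : (μ f).untop h = α := by
    rw [← WithTop.coe_inj, WithTop.coe_untop, hf]
  congr

/-- Two homogeneous classes of grades `α` and `β` agree only if their difference has value
greater than `α` as soon as the first class has a representative of value exactly `α`. -/
theorem lt_sub_of_cls_eq_cls {α β : Γ} {f g : K[X]} (hf : μ f = α) (hg : (β : WithTop Γ) ≤ μ g)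
    (h : cls μ α f hf.ge = cls μ β g hg) : μ f < μ (f - g) := by
  classical
  have h1 := Ideal.Quotient.eq.1 h α
  change (α : WithTop Γ) < μ ((AddMonoidAlgebra.single α f - AddMonoidAlgebra.single β g).coeff α)
    at h1
  rw [AddMonoidAlgebra.coeff_sub, Finsupp.sub_apply, AddMonoidAlgebra.coeff_single, Finsupp.single_apply,
    AddMonoidAlgebra.coeff_single, Finsupp.single_apply, if_pos rfl] at h1
  split_ifs at h1 with h2
  · rwa [hf]
  · rw [sub_zero, hf] at h1
    exact absurd h1 (lt_irrefl _)

theorem cls_eq_cls {α : Γ} {f g : K[X]} (hf : (α : WithTop Γ) ≤ μ f) (hg : (α : WithTop Γ) ≤ μ g)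
    (h : (α : WithTop Γ) < μ (f - g)) : cls μ α f hf = cls μ α g hg := by
  classical
  refine Ideal.Quotient.eq.2 fun β => ?_
  change (β : WithTop Γ) < μ ((AddMonoidAlgebra.single α f - AddMonoidAlgebra.single α g).coeff β)
  rw [← AddMonoidAlgebra.single_sub, AddMonoidAlgebra.coeff_single, Finsupp.single_apply]
  split_ifs with h2
  · rwa [← h2]
  · simp

theorem inTerm_eq_of_lt_sub {f g : K[X]} (h : μ f < μ (f - g)) : inTerm μ f = inTerm μ g := by
  obtain ⟨α, hα⟩ := WithTop.ne_top_iff_exists.1 (ne_top_of_lt h)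
  rw [inTerm_of_coe hα.symm, inTerm_of_coe ((val_eq_of_lt_sub h).trans hα.symm)]
  exact cls_eq_cls _ _ (hα ▸ h)

theorem lt_sub_of_inTerm_eq {f g : K[X]} (hf : μ f ≠ ⊤) (h : inTerm μ f = inTerm μ g) :
    μ f < μ (f - g) := by
  obtain ⟨α, hα⟩ := WithTop.ne_top_iff_exists.1 hf
  rw [inTerm_of_coe hα.symm] at h
  by_cases hg : μ g = ⊤
  · rw [inTerm_of_top hg] at h
    have h0 : cls μ α f hα.le = cls μ α 0 (by simp) :=
      h.trans (Ideal.Quotient.eq_zero_iff_mem.2 fun β => by simp).symm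
    have := lt_sub_of_cls_eq_cls hα.symm _ h0
    rw [sub_zero] at this
    exact absurd this (lt_irrefl _)
  · obtain ⟨β, hβ⟩ := WithTop.ne_top_iff_exists.1 hg
    rw [inTerm_of_coe hβ.symm] at h
    exact lt_sub_of_cls_eq_cls hα.symm _ h

theorem inTerm_mul (f g : K[X]) : inTerm μ (f * g) = inTerm μ f * inTerm μ g := by
  by_cases hf : μ f = ⊤
  · rw [inTerm_of_top hf, inTerm_of_top (by rw [μ.map_mul, hf, WithTop.top_add]), zero_mul]
  by_cases hg : μ g = ⊤
  · rw [inTerm_of_top hg, inTerm_of_top (by rw [μ.map_mul, hg, WithTop.add_top]), mul_zero]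
  obtain ⟨α, hα⟩ := WithTop.ne_top_iff_exists.1 hf
  obtain ⟨β, hβ⟩ := WithTop.ne_top_iff_exists.1 hg
  have hmul : μ (f * g) = ((α + β : Γ) : WithTop Γ) := by
    rw [μ.map_mul, ← hα, ← hβ, WithTop.coe_add]
  rw [inTerm_of_coe hα.symm, inTerm_of_coe hβ.symm, inTerm_of_coe hmul]
  refine congrArg (Ideal.Quotient.mk (reesIdeal μ)) (Subtype.ext ?_)
  exact (AddMonoidAlgebra.single_mul_single ..).symm

theorem InDvd.inTerm_dvd {a b : K[X]} (h : InDvd μ a b) : inTerm μ a ∣ inTerm μ b := by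
  obtain ⟨c, hc⟩ := h
  rw [inTerm_eq_of_lt_sub hc, inTerm_mul]
  exact dvd_mul_right _ _

/-- Divisibility of initial terms descends to polynomials: the cofactor may be replaced by its
homogeneous component of the appropriate grade. -/
theorem inDvd_of_inTerm_dvd {a b : K[X]} (hb : μ b ≠ ⊤) (h : inTerm μ a ∣ inTerm μ b) :
    InDvd μ a b := by
  obtain ⟨β, hβ⟩ := WithTop.ne_top_iff_exists.1 hb
  obtain ⟨x, hx⟩ := h
  by_cases ha : μ a = ⊤
  · rw [inTerm_of_top ha, zero_mul] at hx
    have := lt_sub_of_inTerm_eq hb (hx.trans (inTerm_of_top μ.map_zero).symm)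
    rw [sub_zero] at this
    exact absurd this (lt_irrefl _)
  obtain ⟨α, hα⟩ := WithTop.ne_top_iff_exists.1 ha
  obtain ⟨F, rfl⟩ := Ideal.Quotient.mk_surjective x
  rw [inTerm_of_coe hα.symm, inTerm_of_coe hβ.symm] at hx
  have h1 := Ideal.Quotient.eq.1 hx (α + (β - α))
  change ((α + (β - α) : Γ) : WithTop Γ) <
    μ ((AddMonoidAlgebra.single β b - AddMonoidAlgebra.single α a * F.1).coeff (α + (β - α))) at h1
  rw [AddMonoidAlgebra.coeff_sub, Finsupp.sub_apply, AddMonoidAlgebra.coeff_single_mul_add,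
    add_sub_cancel, AddMonoidAlgebra.coeff_single, Finsupp.single_eq_same] at h1
  exact ⟨F.1.coeff (β - α), hβ ▸ h1⟩

theorem IsKeyPolynomial.inMinimal {φ : K[X]} (h : IsKeyPolynomial μ φ) : InMinimal μ φ :=
  fun a ha hd hdvd => h.minimal a ha hd hdvd.inTerm_dvd

theorem IsKeyPolynomial.inPrime {φ : K[X]} (h : IsKeyPolynomial μ φ) : InPrime μ φ := by
  intro x y hxy
  have hx : μ x ≠ ⊤ := fun hx => hxy.ne_top (by rw [μ.map_mul, hx, WithTop.top_add])
  have hy : μ y ≠ ⊤ := fun hy => hxy.ne_top (by rw [μ.map_mul, hy, WithTop.add_top])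
  have hdvd := hxy.inTerm_dvd
  rw [inTerm_mul] at hdvd
  exact (h.irreducible.2.2 _ _ hdvd).imp (inDvd_of_inTerm_dvd hx) (inDvd_of_inTerm_dvd hy)

theorem inTerm_one : inTerm μ 1 = 1 := inTerm_of_coe (α := (0 : Γ)) μ.map_one

theorem IsKeyPolynomial.not_inDvd_one {φ : K[X]} (h : IsKeyPolynomial μ φ) :
    ¬ InDvd μ φ 1 := fun hd =>
  h.irreducible.not_isUnit (isUnit_of_dvd_one (inTerm_one (μ := μ) ▸ hd.inTerm_dvd))

/-- A `μ`-minimal monic polynomial whose initial term is divisible by that of a `μ`-minimal monic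
polynomial of the same degree has the same initial term. -/
theorem InMinimal.lt_sub_of_inDvd {φ χ : K[X]} (hφ : φ.Monic) (hχ : χ.Monic)
    (hm : InMinimal μ φ) (hdeg : φ.natDegree = χ.natDegree)
    (h : InDvd μ φ χ) : μ χ < μ (χ - φ) := by
  obtain ⟨c, hc⟩ := h
  have hd : (χ - φ).degree < φ.degree := by
    have h1 : χ.degree = φ.degree := by
      rw [degree_eq_natDegree hφ.ne_zero, degree_eq_natDegree hχ.ne_zero, hdeg]
    have := degree_sub_lt_left h1 hχ.ne_zero (by rw [hφ.leadingCoeff, hχ.leadingCoeff])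
    rwa [h1] at this
  refine hc.trans_le ?_
  convert hm.val_add_mul_le hd (1 - c) using 2
  ring

end InitialTerms

/-! ### Augmentations and residual polynomials -/

section Digits

variable {K : Type*} [Field K]

theorem digit_zero (φ f : K[X]) : digit φ f 0 = f %ₘ φ := by
  rw [digit, pow_zero, divByMonic_one]

theorem digit_zero_add_mul {φ : K[X]} (hm : φ.Monic) {a : K[X]} (ha : a.degree < φ.degree)
    (b : K[X]) : digit φ (a + φ * b) 0 = a := by
  rw [digit_zero, add_modByMonic, (modByMonic_eq_self_iff hm).2 ha,
    (modByMonic_eq_zero_iff_dvd hm).2 (dvd_mul_right _ _), add_zero]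

theorem digit_eq_zero_of_degree_lt {φ : K[X]} (hm : φ.Monic) {f : K[X]} {n : ℕ}
    (h : f.degree < (φ ^ n).degree) : digit φ f n = 0 := by
  rw [digit, (divByMonic_eq_zero_iff (hm.pow n)).2 h, zero_modByMonic]

theorem degree_lt_degree_pow {φ : K[X]} (hm : φ.Monic) (hd : 0 < φ.natDegree) {f : K[X]} {n : ℕ}
    (h : f.natDegree < n) : f.degree < (φ ^ n).degree := by
  rw [degree_eq_natDegree (hm.pow n).ne_zero, hm.natDegree_pow]
  exact degree_le_natDegree.trans_lt
    (by exact_mod_cast h.trans_le (Nat.le_mul_of_pos_right n hd))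

theorem digit_eq_zero_of_natDegree_lt {φ : K[X]} (hm : φ.Monic) (hd : 0 < φ.natDegree)
    {f : K[X]} {n : ℕ} (h : f.natDegree < n) : digit φ f n = 0 :=
  digit_eq_zero_of_degree_lt hm (degree_lt_degree_pow hm hd h)

theorem digit_succ_of_degree_lt {φ : K[X]} (hm : φ.Monic) {a : K[X]}
    (ha : a.degree < φ.degree) (n : ℕ) : digit φ a (n + 1) = 0 := by
  refine digit_eq_zero_of_degree_lt hm (ha.trans_le ?_)
  rw [degree_eq_natDegree hm.ne_zero, degree_eq_natDegree (hm.pow _).ne_zero, hm.natDegree_pow]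
  exact_mod_cast Nat.le_mul_of_pos_left _ n.succ_pos

theorem digit_self_one {φ : K[X]} (hm : φ.Monic) (hd : 0 < φ.natDegree) : digit φ φ 1 = 1 := by
  have h1 : (1 : K[X]).degree < φ.degree := by
    rw [degree_one]
    exact natDegree_pos_iff_degree_pos.1 hd
  have : φ /ₘ φ = 1 := by
    have := mul_divByMonic_cancel_left 1 hm
    rwa [mul_one] at this
  rw [digit, pow_one, this, (modByMonic_eq_self_iff hm).2 h1]

theorem digit_self_zero {φ : K[X]} (hm : φ.Monic) : digit φ φ 0 = 0 := by
  rw [digit_zero, (modByMonic_eq_zero_iff_dvd hm).2 dvd_rfl]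

theorem digit_self_of_two_le {φ : K[X]} (hm : φ.Monic) (hd : 0 < φ.natDegree) {n : ℕ}
    (hn : 2 ≤ n) : digit φ φ n = 0 := by
  refine digit_eq_zero_of_degree_lt hm ?_
  rw [degree_eq_natDegree hm.ne_zero, degree_eq_natDegree (hm.pow _).ne_zero, hm.natDegree_pow]
  norm_cast
  nlinarith

theorem digit_sub {φ : K[X]} (hm : φ.Monic) (f g : K[X]) (n : ℕ) :
    digit φ (f - g) n = digit φ f n - digit φ g n := by
  have h : (f - g) /ₘ φ ^ n = f /ₘ φ ^ n - g /ₘ φ ^ n := by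
    refine (div_modByMonic_unique _ (f %ₘ φ ^ n - g %ₘ φ ^ n) (hm.pow n) ⟨?_, ?_⟩).1
    · linear_combination modByMonic_add_div f (φ ^ n) - modByMonic_add_div g (φ ^ n)
    · exact (degree_sub_le _ _).trans_lt
        (max_lt (degree_modByMonic_lt _ (hm.pow n)) (degree_modByMonic_lt _ (hm.pow n)))
  rw [digit, digit, digit, h, sub_modByMonic]

end Digits

section Augmentation

variable {K Γ : Type*} [Field K] [AddCommGroup Γ] [LinearOrder Γ] [IsOrderedAddMonoid Γ]
  {ρ : K[X] → WithTop Γ} {φ : K[X]} {lam : Γ} {μ : AddValuation K[X] (WithTop Γ)}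

theorem IsAugmentation.val_of_degree_lt (h : IsAugmentation ρ φ lam μ) (hm : φ.Monic)
    (hρ : ρ 0 = ⊤) {a : K[X]} (ha : a.degree < φ.degree) :
    μ a = ρ a := by
  have h0 : digit φ a 0 = a := by rw [digit_zero, (modByMonic_eq_self_iff hm).2 ha]
  rw [h a]
  refine le_antisymm ((Finset.inf_le (Finset.mem_range.2 a.natDegree.succ_pos)).trans ?_)
    (Finset.le_inf fun n _ => ?_)
  · rw [h0]; simp
  · cases n with
    | zero => rw [h0]; simp
    | succ n => rw [digit_succ_of_degree_lt hm ha, hρ]; simp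

theorem IsAugmentation.val_self (h : IsAugmentation ρ φ lam μ) (hm : φ.Monic)
    (hd : 0 < φ.natDegree) (hρ : ρ 0 = ⊤) (hρ1 : ρ 1 = 0) : μ φ = lam := by
  rw [h φ]
  refine le_antisymm ((Finset.inf_le (Finset.mem_range.2 (show 1 < _ by omega))).trans ?_)
    (Finset.le_inf fun n _ => ?_)
  · rw [digit_self_one hm hd, hρ1]; simp
  · rcases n with _ | _ | n
    · rw [digit_self_zero hm, hρ]; simp
    · rw [zero_add, digit_self_one hm hd, hρ1]; simp
    · rw [digit_self_of_two_le hm hd (by omega), hρ]; simp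

theorem IsAugmentation.val_digit_mul_pow (h : IsAugmentation ρ φ lam μ) (hm : φ.Monic)
    (hd : 0 < φ.natDegree) (hρ : ρ 0 = ⊤) (hρ1 : ρ 1 = 0) (f : K[X]) (n : ℕ) :
    μ (digit φ f n * φ ^ n) = ρ (digit φ f n) + ((n • lam : Γ) : WithTop Γ) := by
  rw [μ.map_mul, μ.map_pow, h.val_self hm hd hρ hρ1, WithTop.coe_nsmul,
    h.val_of_degree_lt (a := digit φ f n) hm hρ (degree_modByMonic_lt _ hm)]

theorem IsAugmentation.le_val_digit_mul_pow (h : IsAugmentation ρ φ lam μ) (hm : φ.Monic)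
    (hd : 0 < φ.natDegree) (hρ : ρ 0 = ⊤) (hρ1 : ρ 1 = 0) (f : K[X]) (n : ℕ) :
    μ f ≤ μ (digit φ f n * φ ^ n) := by
  rcases lt_or_ge n (f.natDegree + 1) with hn | hn
  · rw [h.val_digit_mul_pow hm hd hρ hρ1, h f]
    exact Finset.inf_le (Finset.mem_range.2 hn)
  · rw [digit_eq_zero_of_natDegree_lt hm hd (by omega)]
    simp

theorem IsAugmentation.val_add_mul_le (h : IsAugmentation ρ φ lam μ) (hm : φ.Monic)
    (hd : 0 < φ.natDegree) (hρ : ρ 0 = ⊤) (hρ1 : ρ 1 = 0) {a : K[X]}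
    (ha : a.degree < φ.degree) (b : K[X]) : μ (a + φ * b) ≤ μ a := by
  have := h.le_val_digit_mul_pow hm hd hρ hρ1 (a + φ * b) 0
  rwa [digit_zero_add_mul hm ha, pow_zero, mul_one] at this

theorem IsAugmentation.inMinimal (h : IsAugmentation ρ φ lam μ) (hm : φ.Monic)
    (hd : 0 < φ.natDegree) (hρ : ρ 0 = ⊤) (hρ1 : ρ 1 = 0) : InMinimal μ φ := by
  rintro a ha had ⟨c, hc⟩
  have := h.val_add_mul_le hm hd hρ hρ1 (degree_lt_degree had) (-c)
  rw [mul_neg, ← sub_eq_add_neg] at this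
  exact absurd hc (not_lt.2 this)

theorem IsAugmentation.minIndices_nonempty (h : IsAugmentation ρ φ lam μ) (hm : φ.Monic)
    (hd : 0 < φ.natDegree) (hρ : ρ 0 = ⊤) (hρ1 : ρ 1 = 0) (f : K[X]) :
    (minIndices μ φ f).Nonempty := by
  obtain ⟨n, -, hn⟩ := Finset.exists_mem_eq_inf (Finset.range (f.natDegree + 1))
    ⟨0, Finset.mem_range.2 f.natDegree.succ_pos⟩
    fun n => ρ (digit φ f n) + ((n • lam : Γ) : WithTop Γ)
  refine ⟨n, ?_⟩
  change μ (digit φ f n * φ ^ n) = μ f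
  rw [h.val_digit_mul_pow hm hd hρ hρ1, h f, hn]

theorem bddAbove_minIndices (hm : φ.Monic) (hd : 0 < φ.natDegree) {f : K[X]} (hf : μ f ≠ ⊤) :
    BddAbove (minIndices μ φ f) := by
  refine ⟨f.natDegree, fun n hn => ?_⟩
  by_contra hlt
  have h1 : μ (digit φ f n * φ ^ n) = μ f := hn
  rw [digit_eq_zero_of_natDegree_lt hm hd (not_le.1 hlt), zero_mul, μ.map_zero] at h1
  exact hf h1.symm

/-- The residual polynomial depends only on the initial term. -/
theorem IsAugmentation.residualPoly_congr (h : IsAugmentation ρ φ lam μ) (hm : φ.Monic)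
    (hd : 0 < φ.natDegree) (hρ : ρ 0 = ⊤) (hρ1 : ρ 1 = 0) (t : Gr μ) {f g : K[X]}
    (hfg : μ f < μ (f - g)) : residualPoly μ φ t f = residualPoly μ φ t g := by
  have hf : μ f ≠ ⊤ := ne_top_of_lt hfg
  have hg : μ g ≠ ⊤ := val_eq_of_lt_sub hfg ▸ hf
  have hf0 : f ≠ 0 := fun h0 => hf (h0 ▸ μ.map_zero)
  have hg0 : g ≠ 0 := fun h0 => hg (h0 ▸ μ.map_zero)
  have hlt : ∀ n, μ f < μ (digit φ f n * φ ^ n - digit φ g n * φ ^ n) := fun n => by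
    rw [← sub_mul, ← digit_sub hm]
    exact hfg.trans_le (h.le_val_digit_mul_pow hm hd hρ hρ1 _ n)
  have hS : minIndices μ φ f = minIndices μ φ g := by
    ext n
    change μ (digit φ f n * φ ^ n) = μ f ↔ μ (digit φ g n * φ ^ n) = μ g
    rw [val_eq_of_lt_sub hfg]
    refine ⟨fun hn => ?_, fun hn => ?_⟩
    · rw [val_eq_of_lt_sub (hn.symm ▸ hlt n), hn]
    · rw [← hn]
      refine val_eq_of_lt_sub ?_
      rw [hn, μ.map_sub_swap]
      exact hlt n
  have hin : ∀ n ∈ minIndices μ φ f, inTerm μ (digit φ f n) = inTerm μ (digit φ g n) := by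
    intro n hn
    have hn' : μ (digit φ f n * φ ^ n) = μ f := hn
    have h1 := hlt n
    rw [← hn', mul_comm, mul_comm _ (φ ^ n)] at h1
    refine inTerm_eq_of_lt_sub ((lt_sub_mul_left ?_).1 h1)
    rw [μ.map_pow, h.val_self hm hd hρ hρ1, ← WithTop.coe_nsmul]
    exact WithTop.coe_ne_top
  have hl := Nat.sSup_mem (h.minIndices_nonempty hm hd hρ hρ1 f) (bddAbove_minIndices hm hd hf)
  unfold residualPoly
  simp only [if_neg hf0, if_neg hg0]
  rw [← hS, ← hin _ hl]
  refine Finset.sum_congr rfl fun j _ => ?_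
  split_ifs with hj
  · rw [hin _ hj]
  · rfl

theorem IsAugmentation.residualPoly_self (h : IsAugmentation ρ φ lam μ) (hm : φ.Monic)
    (hd : 0 < φ.natDegree) (hρ : ρ 0 = ⊤) (hρ1 : ρ 1 = 0) (t : Gr μ) :
    residualPoly μ φ t φ = 1 := by
  have hφ : μ φ ≠ ⊤ := by
    rw [h.val_self hm hd hρ hρ1]
    exact WithTop.coe_ne_top
  have hS : minIndices μ φ φ = {1} := by
    ext n
    change μ (digit φ φ n * φ ^ n) = μ φ ↔ n = 1
    rcases n with _ | _ | n
    · rw [digit_self_zero hm]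
      simpa using hφ.symm
    · rw [zero_add, digit_self_one hm hd]
      simp
    · rw [digit_self_of_two_le hm hd (by omega)]
      simpa using hφ.symm
  unfold residualPoly
  simp only [hS, if_neg hm.ne_zero]
  simp [digit_self_one hm hd, inTerm_one]

theorem residualPoly_of_degree_lt (hm : φ.Monic) (t : Gr μ) {a : K[X]}
    (ha : a.degree < φ.degree) (ha0 : μ a ≠ ⊤) :
    residualPoly μ φ t a = 0 ∨ residualPoly μ φ t a = 1 := by
  have hdig : digit φ a 0 = a := by rw [digit_zero, (modByMonic_eq_self_iff hm).2 ha]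
  have hS : minIndices μ φ a = {0} := by
    ext n
    change μ (digit φ a n * φ ^ n) = μ a ↔ n = 0
    cases n with
    | zero => rw [hdig]; simp
    | succ n =>
      rw [digit_succ_of_degree_lt hm ha]
      simpa using ha0.symm
  have hne : a ≠ 0 := fun h0 => ha0 (h0 ▸ μ.map_zero)
  unfold residualPoly
  simp only [hS, if_neg hne]
  by_cases hu : IsUnit (inTerm μ a)
  · right
    simp only [csInf_singleton, csSup_singleton, Nat.sub_self, Nat.zero_div, zero_add, hdig,
      Finset.sum_range_one, zero_mul, Set.mem_singleton_iff, if_true, pow_zero, mul_one,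
      Ring.inverse_mul_cancel _ hu, C_1]
  · left
    simp [hdig, Ring.inverse_non_unit _ hu]

end Augmentation

section Approximation

variable {K F Γ : Type*} [Field K] [Field F] [Algebra K F] [AddCommGroup Γ] [LinearOrder Γ]
  [IsOrderedAddMonoid Γ]

/-- For each valuation on `F[x]` that extends `vF`, and `ρ` in degrees less than `d ≤ D`, nonzero
polynomials over `F` of degree less than `d` agree to first order with polynomials over `K` of no
larger degree. -/
def HasApproximation (vF : AddValuation F (WithTop Γ)) (ρ : K[X] → WithTop Γ) (D : ℕ) : Prop :=
  ∀ d ≤ D, ∀ μF : AddValuation F[X] (WithTop Γ), (∀ x, μF (C x) = vF x) →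
    (∀ f : K[X], f.natDegree < d → μF (f.map (algebraMap K F)) = ρ f) →
    ∀ f : F[X], f ≠ 0 → f.natDegree < d →
      ∃ f₀ : K[X], f₀.degree ≤ f.degree ∧ μF f < μF (f - f₀.map (algebraMap K F))

/-- First-order approximation propagates along augmentations: the two terms of `f = a + φ b`
are approximated separately, and those over `K` do not cancel. -/
theorem HasApproximation.augmentation {vF : AddValuation F (WithTop Γ)} {ρ : K[X] → WithTop Γ}
    {φ : K[X]} {lam : Γ} {μ : AddValuation K[X] (WithTop Γ)}
    (hA : HasApproximation vF ρ φ.natDegree)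
    (h : IsAugmentation ρ φ lam μ) (hm : φ.Monic) (hd : 0 < φ.natDegree) (hρ : ρ 0 = ⊤)
    (hρ1 : ρ 1 = 0) (D : ℕ) : HasApproximation vF μ D := by
  intro d _ μF hC hμ f
  induction hn : f.natDegree using Nat.strong_induction_on generalizing f with
  | _ n ih =>
  subst hn
  intro hf hfd
  set φF := φ.map (algebraMap K F) with hφF
  have hmF : φF.Monic := hm.map _
  have hdegF : φF.degree = φ.degree := degree_map _ _
  have hlow : ∀ a : F[X], a ≠ 0 → a.natDegree < d → a.degree < φ.degree →
      ∃ f₀ : K[X], f₀.degree ≤ a.degree ∧ μF a < μF (a - f₀.map (algebraMap K F)) := by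
    intro a ha had haφ
    refine hA (min d φ.natDegree) (min_le_right _ _) μF hC (fun b hb => ?_) a ha
      (lt_min had ?_)
    · rw [hμ b (hb.trans_le (min_le_left _ _)), h.val_of_degree_lt hm hρ
        (degree_lt_degree (hb.trans_le (min_le_right _ _)))]
    · rw [← hdegF] at haφ
      rw [← natDegree_map (algebraMap K F)]
      exact natDegree_lt_natDegree ha haφ
  by_cases hlt : f.degree < φ.degree
  · exact hlow f hf hfd hlt
  have hle : φF.degree ≤ f.degree := hdegF ▸ not_lt.1 hlt
  set a := f %ₘ φF with ha
  set b := f /ₘ φF with hb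
  have hdiv : a + φF * b = f := modByMonic_add_div f φF
  have hadeg : a.degree < φ.degree := hdegF ▸ degree_modByMonic_lt f hmF
  have hb0 : b ≠ 0 := fun h0 => absurd ((divByMonic_eq_zero_iff hmF).1 h0) (not_lt.2 hle)
  have hbdeg : φF.degree + b.degree = f.degree := degree_add_divByMonic hmF hle
  have hφd : φ.natDegree ≤ f.natDegree := by
    rw [← natDegree_map (algebraMap K F)]
    exact natDegree_le_natDegree hle
  have hbnat : b.natDegree < f.natDegree := by
    rw [hb, natDegree_divByMonic _ hmF, natDegree_map]
    omega
  obtain ⟨b₀, hb₀deg, hb₀⟩ := ih _ hbnat b rfl hb0 (hbnat.trans hfd)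
  have hφtop : μF φF ≠ ⊤ := by
    rw [hμ φ (hφd.trans_lt hfd), h.val_self hm hd hρ hρ1]
    exact WithTop.coe_ne_top
  have hφb : μF (φF * b) < μF (φF * b - φF * b₀.map (algebraMap K F)) :=
    (lt_sub_mul_left hφtop).2 hb₀
  have hφb₀deg : (φ * b₀).degree ≤ f.degree := by
    rw [degree_mul, ← hdegF, ← hbdeg]
    exact add_le_add_right hb₀deg _
  have ha_approx : μF a ≠ ⊤ → ∃ f₀ : K[X], f₀.degree ≤ a.degree ∧
      μF a < μF (a - f₀.map (algebraMap K F)) := fun hatop =>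
    have ha0 : a ≠ 0 := fun h0 => hatop (h0 ▸ μF.map_zero)
    hlow a ha0 ((natDegree_lt_natDegree ha0 (hadeg.trans_le (hdegF ▸ hle))).trans hfd) hadeg
  rcases lt_trichotomy (μF a) (μF (φF * b)) with hcase | hcase | hcase
  · obtain ⟨a₀, ha₀deg, ha₀⟩ := ha_approx (ne_top_of_lt hcase)
    refine ⟨a₀, ha₀deg.trans (hadeg.le.trans (hdegF ▸ hle)), ?_⟩
    rw [← hdiv, μF.map_add_eq_of_lt_left hcase, add_sub_right_comm]
    exact μF.map_lt_add ha₀ hcase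
  · obtain ⟨a₀, ha₀deg, ha₀⟩ := ha_approx (hcase ▸ ne_top_of_lt hφb)
    have ha₀φ : a₀.degree < φ.degree := ha₀deg.trans_lt hadeg
    have hdeg : (a₀ + φ * b₀).degree ≤ f.degree :=
      (degree_add_le _ _).trans (max_le (ha₀φ.le.trans (hdegF ▸ hle)) hφb₀deg)
    have hnat : ∀ c : K[X], c.degree ≤ f.degree → c.natDegree < d := fun c hc =>
      (natDegree_le_natDegree hc).trans_lt hfd
    have hdiff : μF a < μF (f - (a₀ + φ * b₀).map (algebraMap K F)) := by
      have : f - (a₀ + φ * b₀).map (algebraMap K F) = (a - a₀.map (algebraMap K F)) +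
          (φF * b - φF * b₀.map (algebraMap K F)) := by
        rw [← hdiv, Polynomial.map_add, Polynomial.map_mul]
        ring
      rw [this]
      exact μF.map_lt_add ha₀ (hcase ▸ hφb)
    refine ⟨a₀ + φ * b₀, hdeg, lt_of_le_of_lt ?_ hdiff⟩
    have h1 : μF ((a₀ + φ * b₀).map (algebraMap K F)) ≤ μF a := by
      rw [hμ _ (hnat _ hdeg)]
      refine (h.val_add_mul_le hm hd hρ hρ1 ha₀φ b₀).trans ?_
      rw [← hμ _ (hnat _ (ha₀φ.le.trans (hdegF ▸ hle))), val_eq_of_lt_sub ha₀]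
    by_contra hgt
    have h2 := μF.map_lt_add (not_le.1 hgt) (g := μF a)
      (y := -(f - (a₀ + φ * b₀).map (algebraMap K F))) (by rwa [AddValuation.map_neg])
    rw [neg_sub, add_sub_cancel] at h2
    exact absurd h2 (not_lt.2 h1)
  · refine ⟨φ * b₀, hφb₀deg, ?_⟩
    rw [Polynomial.map_mul, ← hdiv, μF.map_add_eq_of_lt_right hcase, add_sub_assoc]
    exact μF.map_lt_add hcase hφb

theorem hasApproximation_of_immediate {vF : AddValuation F (WithTop Γ)}
    (himm : ∀ c : F, c ≠ 0 → ∃ k : K, vF c < vF (c - algebraMap K F k))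
    (ρ : K[X] → WithTop Γ) : HasApproximation vF ρ 1 := by
  intro d hd μF hC _ f hf hfd
  obtain ⟨c, rfl⟩ := natDegree_eq_zero.1 (show f.natDegree = 0 by omega)
  obtain ⟨k, hk⟩ := himm c (by simpa using hf)
  refine ⟨C k, ?_, ?_⟩
  · rw [degree_C (show c ≠ 0 by simpa using hf)]
    exact degree_C_le
  · rw [map_C, ← C_sub, hC, hC]
    exact hk

theorem nodeVal_zero (v : AddValuation K (WithTop Γ))
    (ν : Option (AddValuation K[X] (WithTop Γ))) : nodeVal v ν 0 = ⊤ := by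
  cases ν <;> simp [nodeVal]

theorem nodeVal_one (v : AddValuation K (WithTop Γ))
    (ν : Option (AddValuation K[X] (WithTop Γ))) : nodeVal v ν 1 = 0 := by
  cases ν <;> simp [nodeVal]

variable [Module ℚ Γ]

theorem Reach.monic {v : AddValuation K (WithTop Γ)} {g : K[X]}
    {ν : Option (AddValuation K[X] (WithTop Γ))} {φ : K[X]} {n : ℕ} (h : Reach v g ν φ n) :
    φ.Monic := by
  cases h with
  | start => exact monic_X
  | step _ _ _ _ _ _ hQ => exact hQ.2.1

theorem Reach.natDegree_pos {v : AddValuation K (WithTop Γ)} {g : K[X]} (hg : g.natDegree ≠ 0)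
    {ν : Option (AddValuation K[X] (WithTop Γ))} {φ : K[X]} {n : ℕ} (h : Reach v g ν φ n) :
    0 < φ.natDegree := by
  cases h with
  | start => simp
  | step _ _ _ _ _ _ hQ =>
    refine Nat.pos_of_ne_zero fun h0 => hg ?_
    rw [← hQ.2.2.1, h0, mul_zero]

theorem Reach.hasApproximation {v : AddValuation K (WithTop Γ)} {g : K[X]}
    (hg : g.natDegree ≠ 0) {vF : AddValuation F (WithTop Γ)}
    (himm : ∀ c : F, c ≠ 0 → ∃ k : K, vF c < vF (c - algebraMap K F k))
    {ν : Option (AddValuation K[X] (WithTop Γ))} {φ : K[X]} {n : ℕ} (h : Reach v g ν φ n) :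
    HasApproximation vF (nodeVal v ν) φ.natDegree := by
  induction h with
  | start =>
    rw [natDegree_X]
    exact hasApproximation_of_immediate himm _
  | step hr _ _ haug _ _ _ ih =>
    exact ih.augmentation haug hr.monic (hr.natDegree_pos hg) (nodeVal_zero v _)
      (nodeVal_one v _) _

end Approximation

/-! ### Partial fractions without cancellation -/

section SecondOrder

variable {R Γ ι : Type*} [CommRing R] [AddCommGroup Γ] [LinearOrder Γ] [IsOrderedAddMonoid Γ]
  [DecidableEq ι] {μ : AddValuation R (WithTop Γ)} {H ε : ι → R} {e : WithTop Γ}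

theorem le_val_mul_prod_erase {T : Finset ι} {i : ι} (hi : i ∈ T) {x : R}
    (h : μ (H i) + e ≤ μ x) : μ (∏ j ∈ T, H j) + e ≤ μ (x * ∏ j ∈ T.erase i, H j) := by
  rw [← Finset.mul_prod_erase T H hi, μ.map_mul, μ.map_mul, add_right_comm]
  gcongr

theorem le_val_first_order {T : Finset ι} (h : ∀ i ∈ T, μ (H i) + e ≤ μ (ε i)) :
    μ (∏ j ∈ T, H j) + e ≤ μ (∑ i ∈ T, ε i * ∏ j ∈ T.erase i, H j) :=
  μ.map_le_sum fun i hi => le_val_mul_prod_erase hi (h i hi)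

/-- A product of perturbed factors agrees with its linearization up to twice the relative
precision of the perturbation. -/
theorem le_val_second_order (he : 0 ≤ e) (T : Finset ι) (h : ∀ i ∈ T, μ (H i) + e ≤ μ (ε i)) :
    μ (∏ j ∈ T, H j) + (e + e) ≤
      μ (∏ j ∈ T, (H j + ε j) - ∏ j ∈ T, H j - ∑ i ∈ T, ε i * ∏ j ∈ T.erase i, H j) := by
  induction T using Finset.induction_on with
  | empty => simp
  | insert k T hk ih =>
    have hT : ∀ i ∈ T, μ (H i) + e ≤ μ (ε i) := fun i hi => h i (Finset.mem_insert_of_mem hi)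
    have hkε := h k (Finset.mem_insert_self k T)
    have hsum : ∑ i ∈ insert k T, ε i * ∏ j ∈ (insert k T).erase i, H j =
        ε k * ∏ j ∈ T, H j + H k * ∑ i ∈ T, ε i * ∏ j ∈ T.erase i, H j := by
      rw [Finset.sum_insert hk, Finset.erase_insert hk, Finset.mul_sum]
      congr 1
      refine Finset.sum_congr rfl fun i hi => ?_
      have hik : i ≠ k := fun h => hk (h ▸ hi)
      rw [Finset.erase_insert_of_ne hik.symm,
        Finset.prod_insert fun h => hk (Finset.mem_of_mem_erase h)]
      ring
    rw [hsum, Finset.prod_insert hk, Finset.prod_insert hk]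
    have hring : (H k + ε k) * ∏ j ∈ T, (H j + ε j) - H k * ∏ j ∈ T, H j -
        (ε k * ∏ j ∈ T, H j + H k * ∑ i ∈ T, ε i * ∏ j ∈ T.erase i, H j) =
        ε k * (∑ i ∈ T, ε i * ∏ j ∈ T.erase i, H j) + (H k + ε k) *
          (∏ j ∈ T, (H j + ε j) - ∏ j ∈ T, H j - ∑ i ∈ T, ε i * ∏ j ∈ T.erase i, H j) := by
      ring
    rw [hring, μ.map_mul]
    refine μ.map_le_add ?_ ?_
    · rw [μ.map_mul, add_add_add_comm]
      exact add_le_add hkε (le_val_first_order hT)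
    · rw [μ.map_mul, add_assoc]
      refine add_le_add (μ.map_le_add le_rfl ?_) (ih hT)
      exact (le_add_of_nonneg_right he).trans hkε

end SecondOrder

section Separated

variable {K Γ ι : Type*} [Field K] [AddCommGroup Γ] [LinearOrder Γ] [IsOrderedAddMonoid Γ]

/-- The initial terms of the `H i` are pairwise coprime, and none divides the initial term of
a polynomial of smaller degree. -/
structure InitialSystem (μ : AddValuation K[X] (WithTop Γ)) (H : ι → K[X]) : Prop where
  coprime : ∀ i j, i ≠ j → InCoprime μ (H i) (H j)
  minimal : ∀ i b, b.degree < (H i).degree → ¬ InDvd μ (H i) b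

theorem InitialSystem.congr {μ : AddValuation K[X] (WithTop Γ)} {P H : ι → K[X]}
    (h : InitialSystem μ P) (hPH : ∀ i, μ (P i) < μ (P i - H i))
    (hdeg : ∀ i, (H i).degree = (P i).degree) : InitialSystem μ H where
  coprime i j hij := ((h.coprime i j hij).congr_left (hPH i)).congr_right (hPH j)
  minimal i b hb hd := h.minimal i b (hdeg i ▸ hb) (hd.congr_left (lt_sub_symm (hPH i)))

theorem InitialSystem.isCoprime {μ : AddValuation K[X] (WithTop Γ)}
    (hfin : ∀ f : K[X], f ≠ 0 → μ f ≠ ⊤) {H : ι → K[X]}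
    (h : InitialSystem μ H) (hm : ∀ i, (H i).Monic) {i j : ι} (hij : i ≠ j) :
    IsCoprime (H i) (H j) := by
  refine isCoprime_of_dvd _ _ (fun h0 => (hm i).ne_zero h0.1) ?_
  rintro d hd hd0 ⟨a, ha⟩ ⟨b, hb⟩
  have ha0 : a ≠ 0 := by
    rintro rfl
    exact (hm i).ne_zero (by rw [ha, mul_zero])
  have hdeg : a.degree < (H i).degree := by
    rw [ha, degree_mul]
    have : 0 < d.degree := degree_pos_of_ne_zero_of_nonunit hd0 hd
    rw [degree_eq_natDegree ha0, degree_eq_natDegree hd0] at *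
    norm_cast at *
    omega
  refine h.minimal i a hdeg (h.coprime i j hij a (inDvd_of_dvd (hfin _ ?_) ⟨b, ?_⟩))
  · exact mul_ne_zero ha0 (hm j).ne_zero
  · rw [hb, ha]
    ring

variable [Fintype ι] [DecidableEq ι]

/-- The terms of a partial fraction numerator with denominators `H i` do not cancel. -/
def Separated (μ : AddValuation K[X] (WithTop Γ)) (H : ι → K[X]) : Prop :=
  ∀ δ : ι → K[X], (∀ i, (δ i).degree < (H i).degree) → ∀ i,
    μ (∑ k, δ k * ∏ j ∈ Finset.univ.erase k, H j) ≤ μ (δ i * ∏ j ∈ Finset.univ.erase i, H j)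

theorem InitialSystem.separated {μ : AddValuation K[X] (WithTop Γ)} {H : ι → K[X]}
    (h : InitialSystem μ H) : Separated μ H := by
  intro δ hδ i
  by_contra hlt
  have hcop : InCoprime μ (H i) (∏ j ∈ Finset.univ.erase i, H j) :=
    InCoprime.prod _ fun j hj => h.coprime i j (Finset.ne_of_mem_erase hj).symm
  have hdvd : H i ∣ ∑ k ∈ Finset.univ.erase i, δ k * ∏ j ∈ Finset.univ.erase k, H j :=
    Finset.dvd_sum fun k hk => Dvd.dvd.mul_left (Finset.dvd_prod_of_mem H
      (Finset.mem_erase.2 ⟨(Finset.ne_of_mem_erase hk).symm, Finset.mem_univ i⟩)) _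
  obtain ⟨c, hc⟩ := hdvd
  refine h.minimal i (δ i) (hδ i) (hcop (δ i) ⟨-c, ?_⟩)
  rw [mul_neg, ← hc, sub_neg_eq_add,
    Finset.add_sum_erase _ (fun k => δ k * ∏ j ∈ Finset.univ.erase k, H j) (Finset.mem_univ i)]
  exact not_le.1 hlt

end Separated

section BaseChange

variable {K F Γ ι : Type*} [Field K] [Field F] [Algebra K F] [AddCommGroup Γ] [LinearOrder Γ]
  [IsOrderedAddMonoid Γ] [Fintype ι] [DecidableEq ι]

/-- Cancellation over `F` would descend to cancellation over `K` on replacing the numerators of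
least value by first-order approximations. -/
theorem Separated.map {μ : AddValuation K[X] (WithTop Γ)} {μF : AddValuation F[X] (WithTop Γ)}
    (hμ : ∀ f : K[X], μF (f.map (algebraMap K F)) = μ f)
    (happ : ∀ f : F[X], f ≠ 0 → ∃ f₀ : K[X], f₀.degree ≤ f.degree ∧
      μF f < μF (f - f₀.map (algebraMap K F)))
    {H : ι → K[X]} (hm : ∀ i, (H i).Monic) (h : Separated μ H) :
    Separated μF fun i => (H i).map (algebraMap K F) := by
  intro δ hδ i
  simp only at hδ ⊢
  have hprod : ∀ k, ∏ j ∈ Finset.univ.erase k, (H j).map (algebraMap K F) =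
      (∏ j ∈ Finset.univ.erase k, H j).map (algebraMap K F) := fun k =>
    (Polynomial.map_prod _ _ _).symm
  obtain ⟨i₀, -, hmin⟩ := Finset.univ.exists_min_image
    (fun k => μF (δ k * ∏ j ∈ Finset.univ.erase k, (H j).map (algebraMap K F)))
    ⟨i, Finset.mem_univ i⟩
  refine le_trans ?_ (hmin i (Finset.mem_univ i))
  by_contra hlt
  rw [not_le] at hlt
  set β := μF (δ i₀ * ∏ j ∈ Finset.univ.erase i₀, (H j).map (algebraMap K F)) with hβ
  have hex : ∀ k, ∃ f₀ : K[X], f₀.degree < (H k).degree ∧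
      β < μF ((δ k - f₀.map (algebraMap K F)) *
        ∏ j ∈ Finset.univ.erase k, (H j).map (algebraMap K F)) := by
    intro k
    rcases eq_or_ne (δ k) 0 with h0 | h0
    · refine ⟨0, ?_, ?_⟩
      · rw [degree_zero, bot_lt_iff_ne_bot, Ne, degree_eq_bot]
        exact (hm k).ne_zero
      · rw [h0, Polynomial.map_zero, sub_zero, zero_mul, μF.map_zero]
        exact (ne_top_of_lt hlt).lt_top
    · obtain ⟨f₀, hd, hf₀⟩ := happ _ h0
      refine ⟨f₀, (hd.trans_lt (hδ k)).trans_eq (degree_map _ _), ?_⟩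
      by_cases htop : μF (∏ j ∈ Finset.univ.erase k, (H j).map (algebraMap K F)) = ⊤
      · rw [μF.map_mul, htop, WithTop.add_top]
        exact (ne_top_of_lt hlt).lt_top
      · refine (hmin k (Finset.mem_univ k)).trans_lt ?_
        rw [μF.map_mul, μF.map_mul]
        exact WithTop.add_lt_add_right htop hf₀
  choose δ₀ hδ₀ hδ₀' using hex
  have h1 : β < μF (∑ k, (δ₀ k).map (algebraMap K F) *
      ∏ j ∈ Finset.univ.erase k, (H j).map (algebraMap K F)) := by
    have : ∑ k, (δ₀ k).map (algebraMap K F) *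
        ∏ j ∈ Finset.univ.erase k, (H j).map (algebraMap K F) =
        ∑ k, δ k * ∏ j ∈ Finset.univ.erase k, (H j).map (algebraMap K F) +
        -∑ k, (δ k - (δ₀ k).map (algebraMap K F)) *
          ∏ j ∈ Finset.univ.erase k, (H j).map (algebraMap K F) := by
      simp only [sub_mul, Finset.sum_sub_distrib]
      ring
    rw [this]
    refine μF.map_lt_add hlt ?_
    rw [AddValuation.map_neg]
    exact μF.map_lt_sum' (ne_top_of_lt hlt).lt_top fun k _ => hδ₀' k
  have h2 := h δ₀ hδ₀ i₀
  rw [← hμ, ← hμ, Polynomial.map_sum] at h2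
  simp only [Polynomial.map_mul, ← hprod] at h2
  have h3 : μF ((δ₀ i₀).map (algebraMap K F) *
      ∏ j ∈ Finset.univ.erase i₀, (H j).map (algebraMap K F)) = β := by
    refine val_eq_of_lt_sub ?_
    rw [← sub_mul]
    exact hδ₀' i₀
  exact absurd (h1.trans_le h2) (h3 ▸ lt_irrefl _)

end BaseChange

section Precision

variable {F Γ ι : Type*} [Field F] [AddCommGroup Γ] [LinearOrder Γ]
  [IsOrderedAddMonoid Γ] [Fintype ι] [DecidableEq ι] {μ : AddValuation F[X] (WithTop Γ)}
  {G H : ι → F[X]}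

theorem degree_sub_lt_of_monic {f g : F[X]} (hf : f.Monic) (hg : g.Monic)
    (h : f.natDegree = g.natDegree) : (f - g).degree < g.degree := by
  have h1 : f.degree = g.degree := by
    rw [degree_eq_natDegree hf.ne_zero, degree_eq_natDegree hg.ne_zero, h]
  have := degree_sub_lt_left h1 hf.ne_zero (by rw [hf.leadingCoeff, hg.leadingCoeff])
  rwa [h1] at this

/-- Quadratic convergence: the Newton correction `δ` doubles the relative precision `e`. -/
theorem Separated.newton (hsep : Separated μ H) (hfin : ∀ i, μ (H i) ≠ ⊤)
    (hG : ∀ i, (G i).Monic) (hH : ∀ i, (H i).Monic)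
    (hdeg : ∀ i, (G i).natDegree = (H i).natDegree) {e : WithTop Γ} (he : 0 ≤ e)
    (hGH : ∀ i, μ (H i) + e ≤ μ (G i - H i)) {δ : ι → F[X]}
    (hδ : ∀ i, (δ i).degree < (H i).degree)
    (hsum : ∏ i, G i - ∏ i, H i = ∑ k, δ k * ∏ j ∈ Finset.univ.erase k, H j) (i : ι) :
    μ (H i) + (e + e) ≤ μ (G i - (H i + δ i)) := by
  have h2 := le_val_second_order he Finset.univ (H := H) (ε := fun j => G j - H j)
    fun j _ => hGH j
  simp only [add_sub_cancel] at h2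
  have hlt : ∀ j, (G j - H j - δ j).degree < (H j).degree := fun j =>
    (degree_sub_le _ _).trans_lt
      (max_lt (degree_sub_lt_of_monic (hG j) (hH j) (hdeg j)) (hδ j))
  have h3 := hsep (fun j => G j - H j - δ j) hlt i
  have h4 : ∑ k, (G k - H k - δ k) * ∏ j ∈ Finset.univ.erase k, H j =
      -(∏ j, G j - ∏ j, H j - ∑ k, (G k - H k) * ∏ j ∈ Finset.univ.erase k, H j) := by
    simp only [sub_mul _ (δ _), Finset.sum_sub_distrib, hsum]
    ring
  simp only [h4, AddValuation.map_neg] at h3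
  have h5 := h2.trans h3
  have hprod : ∀ T : Finset ι, μ (∏ j ∈ T, H j) ≠ ⊤ := fun T => by
    induction T using Finset.induction_on with
    | empty => simp
    | insert k T hk ih =>
      rw [Finset.prod_insert hk, μ.map_mul]
      exact WithTop.add_ne_top.2 ⟨hfin k, ih⟩
  rw [← Finset.mul_prod_erase _ H (Finset.mem_univ i), μ.map_mul, μ.map_mul,
    add_right_comm] at h5
  rw [← sub_sub]
  exact (WithTop.add_le_add_iff_right (hprod _)).1 h5

/-- The relative precision of an approximate factorization with separated initial terms is
read off from the product. -/
theorem Separated.le_val_sub (hsep : Separated μ H) (hfin : ∀ i, μ (H i) ≠ ⊤)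
    (hG : ∀ i, (G i).Monic) (hH : ∀ i, (H i).Monic)
    (hdeg : ∀ i, (G i).natDegree = (H i).natDegree)
    (hGH : ∀ i, μ (H i) < μ (G i - H i)) {γ : WithTop Γ}
    (hγ : μ (∏ i, G i - ∏ i, H i) = μ (∏ i, H i) + γ) (i : ι) :
    μ (H i) + γ ≤ μ (G i - H i) := by
  have hprod : ∀ T : Finset ι, μ (∏ j ∈ T, H j) ≠ ⊤ := fun T => by
    induction T using Finset.induction_on with
    | empty => simp
    | insert k T hk ih =>
      rw [Finset.prod_insert hk, μ.map_mul]
      exact WithTop.add_ne_top.2 ⟨hfin k, ih⟩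
  let term : ι → F[X] := fun k => (G k - H k) * ∏ j ∈ Finset.univ.erase k, H j
  obtain ⟨i₀, -, hmin⟩ := Finset.univ.exists_min_image (fun k => μ (term k))
    ⟨i, Finset.mem_univ i⟩
  obtain ⟨p, hp⟩ := WithTop.ne_top_iff_exists.1 (hprod Finset.univ)
  -- `m` is the relative precision, the least value of a first-order term relative to `∏ H`.
  let m : WithTop Γ := ((-p : Γ) : WithTop Γ) + μ (term i₀)
  have hm : μ (∏ j, H j) + m = μ (term i₀) := by
    rw [← hp, ← add_assoc, ← WithTop.coe_add, add_neg_cancel, WithTop.coe_zero, zero_add]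
  have hm0 : 0 < m := by
    have h1 : μ (∏ j, H j) < μ (∏ j, H j) + m := by
      rw [hm, ← Finset.mul_prod_erase _ H (Finset.mem_univ i₀), μ.map_mul, μ.map_mul]
      exact WithTop.add_lt_add_right (hprod _) (hGH i₀)
    refine (WithTop.add_lt_add_iff_left (hprod Finset.univ)).1 ?_
    rwa [add_zero]
  have hall : ∀ k, μ (H k) + m ≤ μ (G k - H k) := fun k => by
    have h1 : μ (∏ j, H j) + m ≤ μ (term k) := hm ▸ hmin k (Finset.mem_univ k)
    rw [← Finset.mul_prod_erase _ H (Finset.mem_univ k), μ.map_mul, μ.map_mul,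
      add_right_comm] at h1
    exact (WithTop.add_le_add_iff_right (hprod _)).1 h1
  by_cases hmt : m = ⊤
  · have := hall i
    rw [hmt, WithTop.add_top, top_le_iff] at this
    rw [this]
    exact le_top
  have h2 := le_val_second_order hm0.le Finset.univ (H := H) (ε := fun j => G j - H j)
    fun j _ => hall j
  simp only [add_sub_cancel] at h2
  have hfirst : μ (∑ k, term k) = μ (∏ j, H j) + m := by
    rw [hm]
    refine le_antisymm (hsep (fun j => G j - H j)
      (fun j => degree_sub_lt_of_monic (hG j) (hH j) (hdeg j)) i₀) (μ.map_le_sum hmin)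
  have hlt : μ (∑ k, term k) < μ (∏ j, G j - ∏ j, H j - ∑ k, term k) := by
    refine lt_of_lt_of_le ?_ h2
    rw [hfirst]
    refine WithTop.add_lt_add_left (hprod _) ?_
    conv_lhs => rw [← add_zero m]
    exact WithTop.add_lt_add_left hmt hm0
  have hval := μ.map_eq_of_lt_sub hlt
  rw [hfirst, hγ] at hval
  rw [(WithTop.add_left_inj (hprod Finset.univ)).1 hval]
  exact hall i

end Precision

/-! ### The extended Euclidean algorithm and Newton's iteration -/

section Euclid

variable {K : Type*} [Field K]

open Classical in
/-- One division of the extended Euclidean algorithm: the state `(r₀, s₀, r₁, s₁)` consists of two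
consecutive remainders and their cofactors. -/
def euclidStep : K[X] × K[X] × K[X] × K[X] → K[X] × K[X] × K[X] × K[X]
  | (r₀, s₀, r₁, s₁) => if r₁ = 0 then (r₀, s₀, r₁, s₁) else (r₁, s₁, r₀ % r₁, s₀ - r₀ / r₁ * s₁)

/-- The final state of the extended Euclidean algorithm for `(F, Q)`; as many divisions as
`deg Q + 1` suffice. -/
def euclidState (Q F : K[X]) : K[X] × K[X] × K[X] × K[X] :=
  euclidStep^[Q.natDegree + 1] (F, 0, Q, 1)

/-- An inverse of `Q` modulo `F`, if these are coprime. -/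
def invMod (Q F : K[X]) : K[X] := (euclidState Q F).2.1 / (euclidState Q F).1

theorem euclidStep_iterate_spec {Q F : K[X]} (hc : IsCoprime F Q) (k : ℕ) :
    let st := euclidStep^[k] (F, 0, Q, 1)
    IsCoprime st.1 st.2.2.1 ∧ F ∣ st.2.1 * Q - st.1 ∧ F ∣ st.2.2.2 * Q - st.2.2.1 ∧
      (st.2.2.1 = 0 ∨ st.2.2.1.natDegree + k ≤ Q.natDegree) := by
  induction k with
  | zero => simp [hc]
  | succ k ih =>
    rw [Function.iterate_succ_apply']
    obtain ⟨h1, h2, h3, h4⟩ := ih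
    generalize euclidStep^[k] (F, 0, Q, 1) = st at h1 h2 h3 h4 ⊢
    obtain ⟨r₀, s₀, r₁, s₁⟩ := st
    dsimp only at h1 h2 h3 h4
    by_cases h0 : r₁ = 0
    · simp only [euclidStep, if_pos h0]
      exact ⟨h1, h2, h3, Or.inl h0⟩
    · simp only [euclidStep, if_neg h0]
      have hdiv : r₁ * (r₀ / r₁) + r₀ % r₁ = r₀ := EuclideanDomain.div_add_mod r₀ r₁
      refine ⟨?_, h3, ?_, ?_⟩
      · rw [← hdiv] at h1
        exact ((IsCoprime.mul_add_left_left_iff).1 h1).symm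
      · have : (s₀ - r₀ / r₁ * s₁) * Q - r₀ % r₁ =
            (s₀ * Q - r₀) - r₀ / r₁ * (s₁ * Q - r₁) := by
          linear_combination -hdiv
        rw [this]
        exact dvd_sub h2 (Dvd.dvd.mul_left h3 _)
      · by_cases hr : r₀ % r₁ = 0
        · exact Or.inl hr
        · right
          have := natDegree_lt_natDegree hr (degree_mod_lt r₀ h0)
          have := h4.resolve_left h0
          omega

theorem dvd_invMod_mul_sub_one {Q F : K[X]} (hc : IsCoprime F Q) : F ∣ invMod Q F * Q - 1 := by
  obtain ⟨h1, h2, -, h4⟩ := euclidStep_iterate_spec hc (Q.natDegree + 1)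
  change IsCoprime (euclidState Q F).1 (euclidState Q F).2.2.1 at h1
  change F ∣ (euclidState Q F).2.1 * Q - (euclidState Q F).1 at h2
  have h0 : (euclidState Q F).2.2.1 = 0 := h4.resolve_right (by omega)
  rw [h0, isCoprime_zero_right] at h1
  have hdiv : (euclidState Q F).1 * invMod Q F = (euclidState Q F).2.1 :=
    EuclideanDomain.mul_div_cancel' h1.ne_zero h1.dvd
  rw [← hdiv] at h2
  refine (h1.dvd_mul_left (a := F)).1 ?_
  convert h2 using 1
  ring

end Euclid

section Newton

variable {K ι : Type*} [Field K] [Fintype ι]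

/-- Newton's correction of the approximate factorization `g ≈ ∏ H i`. -/
def newtonCorrection (g : K[X]) (H : ι → K[X]) (i : ι) : K[X] :=
  (g * invMod ((∏ j, H j) / H i) (H i)) % H i

/-- Newton's iteration for the factorization `g = ∏ H i`. -/
def newtonStep (g : K[X]) (H : ι → K[X]) (i : ι) : K[X] := H i + newtonCorrection g H i

variable {g : K[X]} {H : ι → K[X]}

theorem degree_newtonCorrection_lt (hH : ∀ i, (H i).Monic) (i : ι) :
    (newtonCorrection g H i).degree < (H i).degree := degree_mod_lt _ (hH i).ne_zero

theorem newtonStep_monic (hH : ∀ i, (H i).Monic) (i : ι) : (newtonStep g H i).Monic :=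
  (hH i).add_of_left (degree_newtonCorrection_lt hH i)

theorem natDegree_newtonStep (hH : ∀ i, (H i).Monic) (i : ι) :
    (newtonStep g H i).natDegree = (H i).natDegree :=
  natDegree_add_eq_left_of_degree_lt (degree_newtonCorrection_lt hH i)

variable [DecidableEq ι]

/-- The corrections solve the linearized equation exactly: both sides agree modulo every `H i`,
and their degrees are less than that of `∏ H i`. -/
theorem sub_prod_eq_sum_newtonCorrection (hg : g.Monic) (hH : ∀ i, (H i).Monic)
    (hcop : ∀ i j, i ≠ j → IsCoprime (H i) (H j)) (hdeg : g.natDegree = (∏ i, H i).natDegree) :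
    g - ∏ i, H i = ∑ k, newtonCorrection g H k * ∏ j ∈ Finset.univ.erase k, H j := by
  have hP : (∏ i, H i).Monic := monic_prod_of_monic _ _ fun i _ => hH i
  rw [← sub_eq_zero]
  refine eq_zero_of_dvd_of_degree_lt (p := ∏ i, H i) ?_ ?_
  · refine Finset.prod_dvd_of_coprime (fun i _ j _ hij => hcop i j hij) fun i _ => ?_
    have hQ : (∏ j, H j) / H i = ∏ j ∈ Finset.univ.erase i, H j := by
      rw [← Finset.mul_prod_erase _ H (Finset.mem_univ i)]
      exact mul_div_cancel_left₀ _ (hH i).ne_zero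
    have hinv := dvd_invMod_mul_sub_one (F := H i) (Q := (∏ j, H j) / H i) (by
      rw [hQ]
      exact IsCoprime.prod_right fun j hj => hcop i j (Finset.ne_of_mem_erase hj).symm)
    have hmod : H i ∣ g * invMod ((∏ j, H j) / H i) (H i) - newtonCorrection g H i :=
      ⟨_, sub_eq_of_eq_add
        (EuclideanDomain.div_add_mod (g * invMod ((∏ j, H j) / H i) (H i)) (H i)).symm⟩
    rw [hQ] at hinv hmod
    have h1 : H i ∣ ∏ j, H j := Finset.dvd_prod_of_mem H (Finset.mem_univ i)
    have h2 : H i ∣ ∑ k ∈ Finset.univ.erase i,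
        newtonCorrection g H k * ∏ j ∈ Finset.univ.erase k, H j :=
      Finset.dvd_sum fun k hk => Dvd.dvd.mul_left (Finset.dvd_prod_of_mem H
        (Finset.mem_erase.2 ⟨(Finset.ne_of_mem_erase hk).symm, Finset.mem_univ i⟩)) _
    rw [← Finset.add_sum_erase _ (fun k => newtonCorrection g H k *
      ∏ j ∈ Finset.univ.erase k, H j) (Finset.mem_univ i)]
    have h3 := ((((hinv.mul_left g).add (h1)).add h2).neg_right).add
      (hmod.mul_right (∏ j ∈ Finset.univ.erase i, H j))
    convert h3 using 1
    ring
  · refine (degree_sub_le _ _).trans_lt (max_lt (degree_sub_lt_of_monic hg hP hdeg) ?_)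
    have hbot : ⊥ < (∏ i, H i).degree := bot_lt_iff_ne_bot.2 (mt degree_eq_bot.1 hP.ne_zero)
    refine (degree_sum_le _ _).trans_lt ((Finset.sup_lt_iff hbot).2 fun k _ => ?_)
    rw [← Finset.mul_prod_erase _ H (Finset.mem_univ k), degree_mul, degree_mul]
    have h0 : (∏ j ∈ Finset.univ.erase k, H j).degree ≠ ⊥ :=
      mt degree_eq_bot.1 (monic_prod_of_monic _ _ fun i _ => hH i).ne_zero
    exact WithBot.add_lt_add_right h0 (degree_newtonCorrection_lt hH k)

end Newton

/-! ### Programs -/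

section Programs

universe u

variable {K : Type u} [Field K]

theorem Data.fold_ofList {R : Type*} (b : Data R) (f : Data R → Data R → Data R)
    (l : List (Data R)) : Data.fold b f (Data.ofList l) = l.foldr f b := by
  induction l with
  | nil => rfl
  | cons a l ih => rw [Data.ofList, Data.fold, ih, List.foldr_cons]

theorem Prog.run_fold_ofList (p q : Prog) (c : Data K[X]) (l : List (Data K[X])) :
    (Prog.fold p q).run (.node c (Data.ofList l)) =
      l.foldr (fun h t => q.run (.node c (.node h t))) (p.run c) :=
  Data.fold_ofList _ _ _

namespace Prog

/-- The product of a list of polynomials, the second entry of the input. -/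
def prodList : Prog := fold one (comp mul right)

theorem run_prodList (c : Data K[X]) (l : List K[X]) :
    prodList.run (.node c (Data.ofList (l.map Data.leaf))) = .leaf l.prod := by
  rw [prodList, run_fold_ofList]
  induction l with
  | nil => simp [run]
  | cons a l ih =>
    rw [List.map_cons, List.foldr_cons, ih, List.prod_cons]
    rfl

/-- The power `f ^ n`, for the input `(f, n)`. -/
def power : Prog := fold one (comp mul (pair left (comp right right)))

theorem run_power (f : K[X]) (n : ℕ) :
    power.run (.node (.leaf f) (Data.ofNat n)) = .leaf (f ^ n) := by
  rw [power, Data.ofNat, run_fold_ofList]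
  induction n with
  | zero => simp [run]
  | succ n ih =>
    rw [List.replicate_succ, List.foldr_cons, ih, pow_succ']
    rfl

/-- The state of the Euclidean algorithm as a datum. -/
def encodeState (st : K[X] × K[X] × K[X] × K[X]) : Data K[X] :=
  .node (.leaf st.1) (.node (.leaf st.2.1) (.node (.leaf st.2.2.1) (.leaf st.2.2.2)))

/-- The body of the loop of the extended Euclidean algorithm. Its input is `(c, (h, st))`. -/
def euclidBody : Prog :=
  let st := comp right right
  let r₀ := comp left st
  let s₀ := comp left (comp right st)
  let r₁ := comp left (comp right (comp right st))
  let s₁ := comp right (comp right (comp right st))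
  ifZero r₁ st (pair r₁ (pair s₁ (pair (comp rem (pair r₀ r₁))
    (comp sub (pair s₀ (comp mul (pair (comp quo (pair r₀ r₁)) s₁)))))))

theorem run_euclidBody (c h : Data K[X]) (st : K[X] × K[X] × K[X] × K[X]) :
    euclidBody.run (.node c (.node h (encodeState st))) = encodeState (euclidStep st) := by
  obtain ⟨r₀, s₀, r₁, s₁⟩ := st
  by_cases h0 : r₁ = 0
  · simp [euclidBody, run, encodeState, euclidStep, Data.left, Data.right, h0]
  · simp [euclidBody, run, encodeState, euclidStep, Data.left, Data.right, Data.op, h0]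

/-- The final state of the extended Euclidean algorithm, for the input `(Q, F)`. -/
def euclidLoop : Prog :=
  comp (fold (pair right (pair zero (pair left one))) euclidBody) (pair id (pair nil (comp deg left)))

theorem run_euclidLoop (Q F : K[X]) :
    euclidLoop.run (.node (.leaf Q) (.leaf F)) = encodeState (euclidState Q F) := by
  have h1 : euclidLoop.run (.node (.leaf Q) (.leaf F)) =
      (fold (pair right (pair zero (pair left one))) euclidBody).run
        (.node (.node (.leaf Q) (.leaf F))
          (Data.ofList (List.replicate (Q.natDegree + 1) Data.nil))) := rfl
  have h2 : (pair right (pair zero (pair left one))).run (.node (.leaf Q) (.leaf F)) =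
      encodeState (F, 0, Q, 1) := rfl
  rw [h1, run_fold_ofList, h2, euclidState]
  induction Q.natDegree + 1 with
  | zero => rfl
  | succ n ih =>
    rw [List.replicate_succ, List.foldr_cons, ih, run_euclidBody, Function.iterate_succ_apply']

/-- The inverse of `Q` modulo `F`, for the input `(Q, F)`. -/
def inverse : Prog := comp (comp quo (pair (comp left right) left)) euclidLoop

theorem run_inverse (Q F : K[X]) :
    inverse.run (.node (.leaf Q) (.leaf F)) = .leaf (invMod Q F) := by
  rw [inverse, run, run_euclidLoop]
  rfl

/-- The corrected factor, for the input `((g, P), (h, l))`, where `h` is the factor to be corrected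
and `P` is the product of all factors. -/
def correctFactor : Prog :=
  let g := comp left left
  let P := comp right left
  let h := comp left right
  comp add (pair h (comp rem (pair (comp mul (pair g
    (comp inverse (pair (comp quo (pair P h)) h)))) h)))

theorem run_correctFactor (g P h : K[X]) (l : Data K[X]) :
    correctFactor.run (.node (.node (.leaf g) (.leaf P)) (.node (.leaf h) l)) =
      .leaf (h + (g * invMod (P / h) h) % h) := by
  have h1 : correctFactor.run (.node (.node (.leaf g) (.leaf P)) (.node (.leaf h) l)) =
      Data.op (· + ·) (.node (.leaf h) (Data.op (· % ·) (.node (Data.op (· * ·)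
        (.node (.leaf g) (inverse.run (.node (.leaf (P / h)) (.leaf h))))) (.leaf h)))) := rfl
  rw [h1, run_inverse]
  rfl

/-- Newton's iteration, for the input `(g, [H₀, …, H_s])`. -/
def hensel : Prog :=
  comp (fold nil (pair correctFactor (comp right right)))
    (pair (pair left (comp prodList (pair nil right))) right)

theorem run_hensel {s : ℕ} (g : K[X]) (H : Fin s → K[X]) :
    hensel.run (.node (.leaf g) (encodePolys H)) = encodePolys (newtonStep g H) := by
  have h0 : encodePolys H = Data.ofList ((List.ofFn H).map Data.leaf) := by
    rw [encodePolys, List.map_ofFn]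
    rfl
  have h1 : hensel.run (.node (.leaf g) (encodePolys H)) =
      (fold nil (pair correctFactor (comp right right))).run
        (.node (.node (.leaf g) (prodList.run (.node .nil (encodePolys H))))
          (encodePolys H)) := rfl
  have h2 : encodePolys (newtonStep g H) = Data.ofList (((List.ofFn H).map fun h =>
      h + (g * invMod ((∏ j, H j) / h) h) % h).map Data.leaf) := by
    rw [encodePolys, List.map_ofFn, List.map_ofFn]
    rfl
  rw [h1, h2, h0, run_prodList, List.prod_ofFn, run_fold_ofList]
  generalize ∏ j, H j = P
  induction List.ofFn H with
  | nil => rfl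
  | cons h l ih =>
    rw [List.map_cons, List.foldr_cons, ih, List.map_cons, List.map_cons, Data.ofList,
      ← run_correctFactor g P h (Data.ofList ((l.map fun h =>
        h + (g * invMod (P / h) h) % h).map Data.leaf))]
    rfl

/-- The list of powers `φᵢ ^ nᵢ`, for the input `(g, [(φ₀, n₀), …, (φ_s, n_s)])`. -/
def powers : Prog :=
  comp (fold nil (pair (comp power (comp left right)) (comp right right))) (pair nil right)

theorem run_powers {s : ℕ} (g : K[X]) (φ : Fin s → K[X]) (n : Fin s → ℕ) :
    powers.run (encodeInput g φ n) = encodePolys fun i => φ i ^ n i := by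
  have h1 : powers.run (encodeInput g φ n) =
      (fold nil (pair (comp power (comp left right)) (comp right right))).run (.node .nil
        (Data.ofList ((List.ofFn fun i => (φ i, n i)).map fun a =>
          Data.node (Data.leaf a.1) (Data.ofNat a.2)))) := by
    rw [List.map_ofFn]
    rfl
  have h2 : encodePolys (fun i => φ i ^ n i) =
      Data.ofList ((List.ofFn fun i => (φ i, n i)).map fun a => Data.leaf (a.1 ^ a.2)) := by
    rw [encodePolys, List.map_ofFn]
    rfl
  rw [h1, h2, run_fold_ofList]
  induction List.ofFn fun i => (φ i, n i) with
  | nil => rfl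
  | cons a l ih =>
    rw [List.map_cons, List.foldr_cons, ih, List.map_cons, Data.ofList, ← run_power]
    rfl

/-- The first approximation: one Newton step from the powers `φᵢ ^ nᵢ`. -/
def initial : Prog := comp hensel (pair left powers)

theorem run_initial {s : ℕ} (g : K[X]) (φ : Fin s → K[X]) (n : Fin s → ℕ) :
    initial.run (encodeInput g φ n) = encodePolys (newtonStep g fun i => φ i ^ n i) := by
  have h1 : initial.run (encodeInput g φ n) =
      hensel.run (.node (.leaf g) (powers.run (encodeInput g φ n))) := rfl
  rw [h1, run_powers, run_hensel]

end Prog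
end Programs

/-! ### Quadratic convergence -/

section Convergence

variable {K F Γ ι : Type*} [Field K] [Field F] [Algebra K F] [AddCommGroup Γ] [LinearOrder Γ]
  [IsOrderedAddMonoid Γ] [Fintype ι] [DecidableEq ι]

/-- Newton's iteration starting from an initial system `P` converges quadratically to the
factorization of `g` over `F` whose factors have the initial terms of the `P i`. -/
theorem newtonStep_iterate_converges {μ : AddValuation K[X] (WithTop Γ)}
    {μF : AddValuation F[X] (WithTop Γ)} (hμ : ∀ f : K[X], μF (f.map (algebraMap K F)) = μ f)
    (happ : ∀ f : F[X], f ≠ 0 → ∃ f₀ : K[X], f₀.degree ≤ f.degree ∧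
      μF f < μF (f - f₀.map (algebraMap K F)))
    {P : ι → K[X]} (hP : ∀ i, (P i).Monic) (hsys : InitialSystem μ P)
    {g : K[X]} (hg : g.Monic) {G : ι → F[X]} (hG : ∀ i, (G i).Monic)
    (hgG : g.map (algebraMap K F) = ∏ i, G i) (hdeg : ∀ i, (G i).natDegree = (P i).natDegree)
    (hGP : ∀ i, μF (G i) < μF (G i - (P i).map (algebraMap K F)))
    {γ : WithTop Γ} (hγ : μ (g - ∏ i, P i) = μ g + γ) :
    0 < γ ∧ ∀ n i, ((newtonStep g)^[n] P i).Monic ∧ μF (G i) + (2 ^ n : ℕ) • γ ≤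
      μF (G i - ((newtonStep g)^[n] P i).map (algebraMap K F)) := by
  have hfinF : ∀ f : F[X], f ≠ 0 → μF f ≠ ⊤ := fun f hf => by
    obtain ⟨f₀, -, h⟩ := happ f hf
    exact ne_top_of_lt h
  have hfin : ∀ f : K[X], f ≠ 0 → μ f ≠ ⊤ := fun f hf =>
    hμ f ▸ hfinF _ ((Polynomial.map_ne_zero_iff (algebraMap K F).injective).2 hf)
  have hmapprod : (∏ i, P i).map (algebraMap K F) = ∏ i, (P i).map (algebraMap K F) :=
    Polynomial.map_prod _ _ _
  have hγF : μF (∏ i, G i - ∏ i, (P i).map (algebraMap K F)) = μF (∏ i, G i) + γ := by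
    rw [← hgG, ← hmapprod, ← Polynomial.map_sub, hμ, hμ, hγ]
  have hprod : μF (∏ i, G i) < μF (∏ i, G i - ∏ i, (P i).map (algebraMap K F)) :=
    lt_sub_prod _ fun i _ => hGP i
  have hγ0 : 0 < γ := by
    rw [hγF] at hprod
    refine (WithTop.add_lt_add_iff_left (ne_top_of_lt hprod)).1 ?_
    rwa [add_zero]
  -- The hypotheses on `P` persist for all later approximations.
  have hsep : ∀ H : ι → K[X], (∀ i, (H i).Monic) → (∀ i, (H i).natDegree = (P i).natDegree) →
      (∀ i, μF (G i) < μF (G i - (H i).map (algebraMap K F))) → InitialSystem μ H := by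
    intro H hH hHd hGH
    refine hsys.congr (fun i => ?_) fun i => ?_
    · have := lt_sub_trans (lt_sub_symm (hGP i)) (hGH i)
      rwa [← Polynomial.map_sub, hμ, hμ] at this
    · rw [degree_eq_natDegree (hH i).ne_zero, degree_eq_natDegree (hP i).ne_zero, hHd]
  have hval : ∀ (H : ι → K[X]) (i : ι), μF (G i) < μF (G i - (H i).map (algebraMap K F)) →
      μF ((H i).map (algebraMap K F)) = μF (G i) := fun H i h => val_eq_of_lt_sub h
  have hdegF : ∀ H : ι → K[X], (∀ i, (H i).natDegree = (P i).natDegree) →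
      ∀ i, (G i).natDegree = ((H i).map (algebraMap K F)).natDegree := fun H hHd i => by
    rw [natDegree_map, hHd, hdeg]
  have hlt_of_le : ∀ {e : WithTop Γ} {H : ι → K[X]} {i : ι}, 0 < e →
      μF (G i) + e ≤ μF (G i - (H i).map (algebraMap K F)) →
      μF (G i) < μF (G i - (H i).map (algebraMap K F)) := fun {e H i} he h => by
    refine lt_of_lt_of_le ?_ h
    conv_lhs => rw [← add_zero (μF (G i))]
    exact WithTop.add_lt_add_left (hfinF _ (hG i).ne_zero) he
  have hpos : ∀ n : ℕ, 0 < (2 ^ n : ℕ) • γ := fun n => withTop_nsmul_pos hγ0 (by positivity)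
  have main : ∀ n, (∀ i, ((newtonStep g)^[n] P i).Monic) ∧
      (∀ i, ((newtonStep g)^[n] P i).natDegree = (P i).natDegree) ∧
      ∀ i, μF (G i) + (2 ^ n : ℕ) • γ ≤
        μF (G i - ((newtonStep g)^[n] P i).map (algebraMap K F)) := by
    intro n
    induction n with
    | zero =>
      refine ⟨hP, fun _ => rfl, fun i => ?_⟩
      have hPG : μF (∏ i, (P i).map (algebraMap K F)) = μF (∏ i, G i) := val_eq_of_lt_sub hprod
      have h := (hsys.separated.map hμ happ hP).le_val_sub
        (fun i => hfinF _ ((hP i).map _).ne_zero) hG (fun i => (hP i).map _)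
        (hdegF P fun _ => rfl) (fun i => (hval P i (hGP i)).symm ▸ hGP i) (hPG.symm ▸ hγF) i
      rw [hval P i (hGP i)] at h
      simpa using h
    | succ n ih =>
      obtain ⟨hH, hHd, hHe⟩ := ih
      rw [Function.iterate_succ_apply']
      set H := (newtonStep g)^[n] P
      have hGH : ∀ i, μF (G i) < μF (G i - (H i).map (algebraMap K F)) := fun i =>
        hlt_of_le (hpos n) (hHe i)
      have hsysH := hsep H hH hHd hGH
      have hdegg : g.natDegree = (∏ i, H i).natDegree := by
        rw [← natDegree_map (algebraMap K F), hgG, natDegree_prod_of_monic _ _ fun i _ => hG i,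
          natDegree_prod_of_monic _ _ fun i _ => hH i]
        exact Finset.sum_congr rfl fun i _ => (hdeg i).trans (hHd i).symm
      have hsum := sub_prod_eq_sum_newtonCorrection hg hH
        (fun i j hij => hsysH.isCoprime hfin hH hij) hdegg
      refine ⟨newtonStep_monic hH, fun i => (natDegree_newtonStep hH i).trans (hHd i),
        fun i => ?_⟩
      have h := (hsysH.separated.map hμ happ hH).newton
        (fun i => hfinF _ ((hH i).map _).ne_zero) hG (fun i => (hH i).map _)
        (hdegF H hHd) (hpos n).le (fun i => (hval H i (hGH i)).symm ▸ hHe i)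
        (δ := fun i => (newtonCorrection g H i).map (algebraMap K F))
        (fun i => by
          rw [degree_map, degree_map]
          exact degree_newtonCorrection_lt hH i)
        (by
          have := congrArg (Polynomial.map (algebraMap K F)) hsum
          simpa only [Polynomial.map_sub, Polynomial.map_prod, Polynomial.map_sum,
            Polynomial.map_mul, hgG] using this) i
      rw [hval H i (hGH i), ← Polynomial.map_add, ← add_nsmul, ← two_mul, ← pow_succ'] at h
      exact h
  exact ⟨hγ0, fun n i => ⟨(main n).1 i, (main n).2.2 i⟩⟩

end Convergence

section KeyPolynomials

universe u v

variable {K : Type u} {Γ : Type v} [Field K] [AddCommGroup Γ] [LinearOrder Γ]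
  [IsOrderedAddMonoid Γ] {μ : AddValuation K[X] (WithTop Γ)}

/-- Between key polynomials, divisibility of initial terms is equality. -/
theorem IsKeyPolynomial.lt_sub_of_inDvd {χ χ' : K[X]} (hχ : IsKeyPolynomial μ χ)
    (hχ' : IsKeyPolynomial μ χ') (h : InDvd μ χ χ') : μ χ' < μ (χ' - χ) := by
  refine hχ.inMinimal.lt_sub_of_inDvd hχ.monic hχ'.monic (le_antisymm ?_ ?_) h
  · by_contra hlt
    exact hχ.inMinimal χ' hχ'.monic.ne_zero (not_le.1 hlt) h
  · by_contra hlt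
    obtain ⟨c, hc⟩ := h
    have h1 : InDvd μ χ' (χ * c) := ⟨1, by rw [mul_one]; exact lt_sub_symm hc⟩
    have hχ'top : μ χ' ≠ ⊤ := ne_top_of_lt hc
    obtain ⟨y, hy⟩ := (hχ'.inPrime χ c h1).resolve_left
      (hχ'.inMinimal χ hχ.monic.ne_zero (not_le.1 hlt))
    have hχtop : μ χ ≠ ⊤ := fun h0 => hχ'top (by
      rw [← val_eq_of_lt_sub hc, μ.map_mul, h0, WithTop.top_add])
    refine hχ.not_inDvd_one ⟨y, (lt_sub_mul_left hχ'top).1 ?_⟩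
    rw [mul_one]
    refine lt_sub_trans hc ?_
    rw [mul_left_comm χ']
    exact (lt_sub_mul_left hχtop).2 hy

/-- The initial terms of `φ` and of lifts of distinct irreducible residual polynomials are pairwise
coprime. Distinct lifts have distinct initial terms because residual polynomials depend only on
initial terms, and `φ` is told apart from them by its trivial residual polynomial. -/
theorem IsAugmentation.initialSystem {ρ : K[X] → WithTop Γ} {φ : K[X]} {lam : Γ}
    (h : IsAugmentation ρ φ lam μ) (hm : φ.Monic) (hd : 0 < φ.natDegree) (hρ : ρ 0 = ⊤)
    (hρ1 : ρ 1 = 0) (hfin : ∀ f : K[X], f ≠ 0 → μ f ≠ ⊤) (t : Gr μ) {s : ℕ}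
    {ψ : Fin s → (kappa μ)[X]} (hψ : ∀ i, Irreducible (ψ i)) (hinj : Function.Injective ψ)
    {φs : Fin (s + 1) → K[X]} (ns : Fin (s + 1) → ℕ) (h0 : φs 0 = φ)
    (hφs : ∀ i : Fin s, IsKeyPolynomial μ (φs i.succ) ∧
      residualPoly μ φ t (φs i.succ) = (ψ i).map (kappa μ).subtype) :
    InitialSystem μ fun i => φs i ^ ns i := by
  have hmapinj : Function.Injective (Polynomial.map (kappa μ).subtype) :=
    Polynomial.map_injective _ (kappa μ).subtype_injective
  have hmonic : ∀ i, (φs i).Monic := Fin.cases (h0 ▸ hm) fun i => (hφs i).1.monic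
  have hmin : ∀ i, InMinimal μ (φs i) :=
    Fin.cases (h0 ▸ h.inMinimal hm hd hρ hρ1) fun i => (hφs i).1.inMinimal
  have hψ1 : ∀ i, (ψ i).map (kappa μ).subtype ≠ 1 := fun i hi =>
    (hψ i).ne_one (hmapinj (hi.trans (Polynomial.map_one _).symm))
  have hψ0 : ∀ i, (ψ i).map (kappa μ).subtype ≠ 0 := fun i hi =>
    (hψ i).ne_zero (hmapinj (hi.trans (Polynomial.map_zero _).symm))
  have hdeg : ∀ i : Fin s, φ.natDegree ≤ (φs i.succ).natDegree := fun i => by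
    by_contra hlt
    have hne := (hφs i).1.monic.ne_zero
    rcases residualPoly_of_degree_lt hm t (degree_lt_degree (not_le.1 hlt)) (hfin _ hne) with hR | hR
    · exact hψ0 i ((hφs i).2.symm.trans hR)
    · exact hψ1 i ((hφs i).2.symm.trans hR)
  have hnot : ∀ (i : Fin s) (j : Fin (s + 1)), j ≠ i.succ → ¬ InDvd μ (φs i.succ) (φs j) := by
    intro i
    refine Fin.cases (fun _ hdvd => ?_) fun j hj hdvd => ?_
    · rw [h0] at hdvd
      rcases (hdeg i).lt_or_eq with hlt | heq
      · exact (hφs i).1.inMinimal φ hm.ne_zero hlt hdvd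
      · have hlt := (hφs i).1.inMinimal.lt_sub_of_inDvd (hφs i).1.monic hm heq.symm hdvd
        have hR := h.residualPoly_congr hm hd hρ hρ1 t hlt
        rw [h.residualPoly_self hm hd hρ hρ1, (hφs i).2] at hR
        exact hψ1 i hR.symm
    · have hlt := (hφs i).1.lt_sub_of_inDvd (hφs j).1 hdvd
      have hR := h.residualPoly_congr hm hd hρ hρ1 t hlt
      rw [(hφs j).2, (hφs i).2] at hR
      exact hj (congrArg Fin.succ (hinj (hmapinj hR)))
  refine ⟨fun i => ?_, fun i b hb =>
    (hmin i).not_inDvd_pow (hmonic i) (hfin _ (hmonic i).ne_zero) _ b hb⟩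
  refine Fin.cases (motive := fun i => ∀ j, i ≠ j → InCoprime μ (φs i ^ ns i) (φs j ^ ns j))
    (fun j hj => ?_) (fun i j hij => ?_) i
  · obtain ⟨k, rfl⟩ := Fin.exists_succ_eq.2 hj.symm
    have hk := (hφs k).1
    exact (hk.inPrime.inCoprime_right (hk.inPrime.not_inDvd_pow hk.not_inDvd_one
      (hnot k 0 (Fin.succ_ne_zero k).symm) _)).pow _
  · exact ((hφs i).1.inPrime.pow_inCoprime (hnot i j hij.symm) _).pow _

end KeyPolynomials

end

end OM

theorem mainTheorem7 :
    ∃ start step : OM.Prog,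
    ∀ (K : Type*) [Field K]
      (Γ : Type*) [AddCommGroup Γ] [LinearOrder Γ] [IsOrderedAddMonoid Γ] [Module ℚ Γ]
      (v : AddValuation K (WithTop Γ))
      -- `Γ` is the divisible hull of the value group of `v`
      (_ : ∀ α : Γ, ∃ n : ℕ, 0 < n ∧ ∃ x : K, v x = ((n • α : Γ) : WithTop Γ))
      (Kbar : Type*) [Field Kbar] [Algebra K Kbar] [IsAlgClosure K Kbar]
      (vbar : AddValuation Kbar (WithTop Γ))
      (_ : ∀ x : K, vbar (algebraMap K Kbar x) = v x)
      (g : K[X]) (_ : g.Monic) (_ : Squarefree g)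
      (_ : ¬ ringChar (IsLocalRing.ResidueField
        (AddValuation.toValuation v).valuationSubring) ∣ g.natDegree)
      (_ : ¬ Irreducible (g.map (algebraMap K (OM.Henselization K vbar))))
      (ν : Option (AddValuation K[X] (WithTop Γ))) (φ : K[X])
      (_ : OM.IsSplittingPair v g ν φ)
      (lam : Γ)
      (_ : OM.IsRightEndSlope (OM.newtonPolygon (OM.nodeVal v ν) φ g) lam)
      (μ : AddValuation K[X] (WithTop Γ))
      (_ : OM.IsAugmentation (OM.nodeVal v ν) φ lam μ)
      (t : OM.Gr μ) (_ : OM.IsResidualUnit μ φ t)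
      -- factorization of the residual polynomial, and lifts of its irreducible factors
      (s : ℕ) (ψ : Fin s → (OM.kappa μ)[X])
      (_ : ∀ i, (ψ i).Monic ∧ Irreducible (ψ i)) (_ : Function.Injective ψ)
      (φs : Fin (s + 1) → K[X]) (ns : Fin (s + 1) → ℕ)
      (_ : φs 0 = φ)
      (_ : IsLeast (Prod.fst '' OM.component (OM.newtonPolygon (OM.nodeVal v ν) φ g) lam)
        (ns 0 : ℚ))
      (_ : ∀ i : Fin s, 0 < ns i.succ)
      (_ : OM.residualPoly μ φ t g =
        (∏ i : Fin s, ψ i ^ ns i.succ).map (OM.kappa μ).subtype)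
      (_ : ∀ i : Fin s, OM.IsKeyPolynomial μ (φs i.succ) ∧
        OM.residualPoly μ φ t (φs i.succ) = (ψ i).map (OM.kappa μ).subtype)
      -- the common extension of `μ` and of the valuation of the henselization
      (μh : AddValuation (OM.Henselization K vbar)[X] (WithTop Γ))
      (_ : ∀ x : OM.Henselization K vbar, μh (C x) = OM.henselVal K vbar x)
      (_ : ∀ f : K[X], μh (f.map (algebraMap K (OM.Henselization K vbar))) = μ f)
      -- the factors of `g` over the henselization
      (G : Fin (s + 1) → (OM.Henselization K vbar)[X])
      (_ : ∀ i, (G i).Monic)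
      (_ : g.map (algebraMap K (OM.Henselization K vbar)) = ∏ i, G i)
      (_ : ∀ i, OM.inTerm μh (G i) =
        OM.inTerm μh ((φs i ^ ns i).map (algebraMap K (OM.Henselization K vbar))))
      (_ : ∀ i, (G i).natDegree = (φs i ^ ns i).natDegree)
      (γ : WithTop Γ) (_ : μ (g - ∏ i, φs i ^ ns i) = μ g + γ),
      0 < γ ∧
      ∃ Gn : ℕ → Fin (s + 1) → K[X],
        (∀ n, OM.encodePolys (Gn n) =
          (fun x => step.run (OM.Data.node (OM.Data.leaf g) x))^[n]
            (start.run (OM.encodeInput g φs ns))) ∧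
        ∀ n i, (Gn n i).Monic ∧
          (γ ≠ ⊤ →
            μh (G i) + (2 ^ n : ℕ) • γ <
              μh (G i - (Gn n i).map (algebraMap K (OM.Henselization K vbar)))) ∧
          (γ = ⊤ → G i = (Gn n i).map (algebraMap K (OM.Henselization K vbar))) := by
  refine ⟨OM.Prog.initial, OM.Prog.hensel, ?_⟩
  intro K _ Γ _ _ _ _ v htors Kbar _ _ _ vbar hvbar g hg _ hchar _ ν φ hpair lam _ μ haug t _ s ψ hψ
    hinj φs ns h0 _ _ _ hφs μh hμC hμ G hG hgG hin hdeg γ hγ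
  have hg0 : g.natDegree ≠ 0 := fun h => hchar (h ▸ dvd_zero _)
  obtain ⟨n, hreach, -⟩ := hpair
  have hm := hreach.monic
  have hd := hreach.natDegree_pos hg0
  have hA := hreach.hasApproximation hg0 (vF := OM.henselVal K vbar) fun c hc =>
    OM.henselization_exists_approx htors vbar hvbar hc
  have happ : ∀ f : (OM.Henselization K vbar)[X], f ≠ 0 → ∃ f₀ : K[X], f₀.degree ≤ f.degree ∧
      μh f < μh (f - f₀.map (algebraMap K (OM.Henselization K vbar))) := fun f hf =>
    hA.augmentation haug hm hd (OM.nodeVal_zero v ν) (OM.nodeVal_one v ν) (f.natDegree + 1) _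
      le_rfl μh hμC (fun f _ => hμ f) f hf (Nat.lt_succ_self _)
  have hfinF : ∀ f : (OM.Henselization K vbar)[X], f ≠ 0 → μh f ≠ ⊤ := fun f hf => by
    obtain ⟨f₀, -, h⟩ := happ f hf
    exact ne_top_of_lt h
  have hfin : ∀ f : K[X], f ≠ 0 → μ f ≠ ⊤ := fun f hf =>
    hμ f ▸ hfinF _ ((Polynomial.map_ne_zero_iff (algebraMap K _).injective).2 hf)
  have hmonic : ∀ i, (φs i).Monic := Fin.cases (h0 ▸ hm) fun i => (hφs i).1.monic
  have hsys := haug.initialSystem hm hd (OM.nodeVal_zero v ν) (OM.nodeVal_one v ν) hfin t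
    (fun i => (hψ i).2) hinj ns h0 hφs
  obtain ⟨hγ0, hconv⟩ := OM.newtonStep_iterate_converges hμ happ (fun i => (hmonic i).pow (ns i))
    hsys hg hG hgG hdeg (fun i => OM.lt_sub_of_inTerm_eq (hfinF _ (hG i).ne_zero) (hin i)) hγ
  refine ⟨hγ0, fun n => (OM.newtonStep g)^[n + 1] fun i => φs i ^ ns i, fun n => ?_, fun n i =>
    ⟨(hconv (n + 1) i).1, fun hγtop => ?_, fun hγtop => ?_⟩⟩
  · rw [OM.Prog.run_initial]
    induction n with
    | zero => rfl
    | succ n ih =>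
      rw [Function.iterate_succ_apply' _ n (OM.encodePolys _), ← ih, OM.Prog.run_hensel]
      exact congrArg _ (Function.iterate_succ_apply' _ _ _)
  · refine lt_of_lt_of_le ?_ (hconv (n + 1) i).2
    have hpos : 0 < (2 ^ n : ℕ) • γ := OM.withTop_nsmul_pos hγ0 (by positivity)
    have htop : (2 ^ n : ℕ) • γ ≠ ⊤ := by
      obtain ⟨c, rfl⟩ := WithTop.ne_top_iff_exists.1 hγtop
      rw [← WithTop.coe_nsmul]
      exact WithTop.coe_ne_top
    refine WithTop.add_lt_add_left (hfinF _ (hG i).ne_zero) ?_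
    rw [pow_succ, mul_two, add_nsmul]
    conv_lhs => rw [← add_zero ((2 ^ n : ℕ) • γ)]
    exact WithTop.add_lt_add_left htop hpos
  · have htop : (2 ^ (n + 1) : ℕ) • γ = ⊤ := by
      rw [hγtop, pow_succ, mul_two, add_nsmul]
      obtain ⟨m, hm⟩ : ∃ m, 2 ^ n = m + 1 := Nat.exists_eq_succ_of_ne_zero (by positivity)
      rw [hm, succ_nsmul, WithTop.add_top, WithTop.add_top]
    have h := (hconv (n + 1) i).2
    rw [htop, WithTop.add_top, top_le_iff] at h
    by_contra hne
    exact hfinF _ (sub_ne_zero.2 hne) h
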